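/- Let $M\ge 0$ be an integer, $\delta_1,\dots,\delta_M\in\mathbb{R}$, $\gamma>0$, and let $g\in L^2(\mathbb{R})$ be the function whose Fourier transform $\hat g(\xi)=\int_{\mathbb{R}} g(x)e^{-2\pi i x\xi}\,dx$ (in the sense of Plancherel) is $$\hat g(\xi)=e^{-\gamma\xi^2}\prod_{j=1}^{M}(1+2\pi i\delta_j\xi)^{-1}\qquad\text{for almost every }\xi\in\mathbb{R}.$$ (By Schoenberg's theorem such a $g$ is, up to a null set, a totally positive function; every totally positive function with this Fourier transform is covered.) Let $\alpha,\beta>0$ be such that $\alpha\beta$ is rational and $\alpha\beta\le 1$. Then the Gabor system $$\mathcal{G}(g,\alpha,\beta)=\{\,e^{2\pi i\beta l x}g(x-\alpha k) : k,l\in\mathbb{Z}\,\}$$ is complete in $L^2(\mathbb{R})$, that is, its complex linear span is dense in $L^2(\mathbb{R})$. -/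

import Mathlib

open MeasureTheory

noncomputable section

namespace GaborSystem

/-- The translation operator `T_a f (x) = f (x - a)`. -/
def translation (a : ℝ) (f : ℝ → ℂ) : ℝ → ℂ := fun x => f (x - a)

/-- The modulation operator `M_b f (x) = e^{2π i b x} f(x)`. -/
def modulation (b : ℝ) (f : ℝ → ℂ) : ℝ → ℂ :=
  fun x => Complex.exp (2 * Real.pi * Complex.I * b * x) * f x

theorem memLp_translation {f : ℝ → ℂ} (hf : MemLp f 2 volume) (a : ℝ) :
    MemLp (translation a f) 2 volume :=
  hf.comp_measurePreserving (measurePreserving_sub_right volume a)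

theorem memLp_modulation {f : ℝ → ℂ} (hf : MemLp f 2 volume) (b : ℝ) :
    MemLp (modulation b f) 2 volume := by
  have hc : Continuous fun x : ℝ => Complex.exp (2 * Real.pi * Complex.I * b * x) := by
    fun_prop
  refine hf.of_le (hc.aestronglyMeasurable.mul hf.1) (Filter.Eventually.of_forall fun x => ?_)
  have h : (2 * Real.pi * Complex.I * b * x : ℂ) = ((2 * Real.pi * b * x : ℝ) : ℂ) * Complex.I := by
    push_cast; ring
  rw [modulation, norm_mul, h, Complex.norm_exp_ofReal_mul_I, one_mul]

/-- The time-frequency shift `M_b T_a g` of `g ∈ L²(ℝ)`, as an element of `L²(ℝ)`. -/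
def timeFrequencyShift (b a : ℝ) (g : Lp ℂ 2 (volume : Measure ℝ)) :
    Lp ℂ 2 (volume : Measure ℝ) :=
  (memLp_modulation (memLp_translation (Lp.memLp g) a) b).toLp (modulation b (translation a g))

/-- The Gabor system `𝒢(g, α, β) = {M_{βl} T_{αk} g : k, l ∈ ℤ}`. -/
def gaborSystem (g : Lp ℂ 2 (volume : Measure ℝ)) (α β : ℝ) :
    Set (Lp ℂ 2 (volume : Measure ℝ)) :=
  {f | ∃ k l : ℤ, f = timeFrequencyShift (β * l) (α * k) g}

/-- A set of elements of `L²(ℝ)` is complete if its complex linear span is dense. -/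
def IsCompleteSystem (S : Set (Lp ℂ 2 (volume : Measure ℝ))) : Prop :=
  Dense (Submodule.span ℂ S : Set (Lp ℂ 2 (volume : Measure ℝ)))

end GaborSystem

end

/-! Density of the span means that only f = 0 is orthogonal to every time-frequency shift. Taking
Fourier transforms (`fourier_timeFrequencyShift`) and rescaling to α = 1 leaves a window W of the
same form and αβ = p/q ≤ 1. Orthogonality to all integer modulations annihilates the periodization
of f·W(· - lp/q) (`periodization_eq_zero`). Hence for almost every ξ the ℓ² sequence f(ξ+n)
satisfies ∑ₙ f(ξ+n) W(ξ+n-lp/q) = 0 for all l. Writing n = s+pj and keeping only l = qm+r with 0 ≤ r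
< p gives p convolution equations in p unknown sequences. By `eq_zero_of_convolution_eq_zero` it
suffices that their symbol `windowMatrix` is invertible for almost every ξ and x.

Its determinant is analytic in ξ off a closed countable set of poles, whose complement is connected
and contains the real line, so for fixed x one nonzero value is enough
(`ae_det_windowMatrix_ne_zero`). Such a value is found high on the imaginary axis. There the
rational factors of W are asymptotically constant, and for suitable heights the matrix is, up to
invertible diagonal factors, close to the Gaussian matrix with entries ∑ⱼ e^{-γ(s-yᵣ+pj)²} κʲ, where
yᵣ = pr/q and κ = e^{2πix}.

The Gaussian matrix is inverted by theta functions (`det_gaussEntry_ne_zero`). Applied to weighted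
Laurent coefficients of a theta function of degree p with multiplier κ, it samples that function at
the points e^{2γyᵣ}. A product of p thetas of degree one can vanish at all sample points but one.
The multiplier then dictates the last zero, a real multiple of κ⁻¹, which for non-real κ does not
spoil the remaining positive sample point. The zeros of the degree one theta come from the Jacobi
triple product (`tsum_theta_ne_zero`). -/

noncomputable section

namespace GaborSystem

open Filter Topology Finset

/-! ### The Jacobi triple product -/

/-- The `q²`-Pochhammer symbol `∏_{i=1}^n (1 - q^{2i})`. -/
def qPoch (q : ℂ) (n : ℕ) : ℂ := ∏ i ∈ range n, (1 - q ^ (2 * (i + 1)))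

/-- The reciprocal of `qPoch`, extended by zero to negative integers. -/
def qPochInv (q : ℂ) (k : ℤ) : ℂ := if 0 ≤ k then (qPoch q k.toNat)⁻¹ else 0

theorem one_sub_pow_ne_zero {q : ℂ} (hq : ‖q‖ < 1) {n : ℕ} (hn : n ≠ 0) : 1 - q ^ n ≠ 0 := by
  intro h
  have h1 : ‖q ^ n‖ = 1 := by rw [← sub_eq_zero.mp h]; simp
  rw [norm_pow] at h1
  exact absurd h1 (pow_lt_one₀ (norm_nonneg _) hq hn).ne

/-- At k = 0 the factor 1 - q⁰ vanishes, in agreement with the extension by zero. The recurrence for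
the coefficients therefore has no boundary cases. -/
theorem qPochInv_sub_one {q : ℂ} (hq : ‖q‖ < 1) (k : ℤ) :
    qPochInv q (k - 1) = (1 - q ^ (2 * k)) * qPochInv q k := by
  rcases lt_trichotomy k 0 with hk | rfl | hk
  · rw [qPochInv, qPochInv, if_neg (by omega), if_neg (by omega), mul_zero]
  · simp [qPochInv]
  · obtain ⟨n, rfl⟩ : ∃ n : ℕ, k = n + 1 := ⟨(k - 1).toNat, by omega⟩
    have h1 : ((n : ℤ) + 1).toNat = n + 1 := by omega
    have h2 : q ^ (2 * ((n : ℤ) + 1)) = q ^ (2 * (n + 1)) := by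
      rw [← zpow_natCast]; push_cast; rfl
    have h3 : (0 : ℤ) ≤ n + 1 := by omega
    have h4 := one_sub_pow_ne_zero hq (n := 2 * (n + 1)) (by positivity)
    simp only [qPochInv, h3, if_true, h1, add_sub_cancel_right, Int.natCast_nonneg, Int.toNat_natCast,
      h2]
    rw [qPoch, qPoch, prod_range_succ, mul_inv, mul_comm, mul_assoc, inv_mul_cancel₀ h4, mul_one]

/-- The coefficients of the finite triple product. -/
def tripleCoeff (q : ℂ) (N : ℕ) (m : ℤ) : ℂ :=
  (-1) ^ m * q ^ (m * m - m) * qPoch q (2 * N) * qPochInv q (N + m) * qPochInv q (N - m)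

/-- This is multiplication by the next factor (1 - xq^{2N})(1 - x⁻¹q^{2N+2}), read off on
coefficients. Once every reciprocal is expressed through those at N+1+m and N+1-m, it is a rational
identity in q, q^{2N} and q^{2m}. -/
theorem tripleCoeff_succ {q : ℂ} (h0 : q ≠ 0) (hq : ‖q‖ < 1) (N : ℕ) (m : ℤ) :
    tripleCoeff q (N + 1) m = (1 + q ^ (4 * N + 2)) * tripleCoeff q N m
      - q ^ (2 * N) * tripleCoeff q N (m - 1) - q ^ (2 * N + 2) * tripleCoeff q N (m + 1) := by
  have hY : q ^ (2 * m) ≠ 0 := zpow_ne_zero _ h0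
  have e1 : q ^ ((m - 1) * (m - 1) - (m - 1)) = q ^ (m * m - m) * q ^ 2 * (q ^ (2 * m))⁻¹ := by
    rw [← zpow_neg, ← zpow_natCast, ← zpow_add₀ h0, ← zpow_add₀ h0]; congr 1; push_cast; ring
  have e2 : q ^ ((m + 1) * (m + 1) - (m + 1)) = q ^ (m * m - m) * q ^ (2 * m) := by
    rw [← zpow_add₀ h0]; congr 1; ring
  have s1 : ((-1 : ℂ)) ^ (m - 1) = - (-1) ^ m := by rw [zpow_sub_one₀ (by norm_num)]; norm_num
  have s2 : ((-1 : ℂ)) ^ (m + 1) = - (-1) ^ m := by rw [zpow_add_one₀ (by norm_num)]; norm_num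
  have p1 : qPoch q (2 * (N + 1)) =
      qPoch q (2 * N) * (1 - (q ^ (2 * N)) ^ 2 * q ^ 2) * (1 - (q ^ (2 * N)) ^ 2 * q ^ 4) := by
    rw [qPoch, qPoch, show 2 * (N + 1) = 2 * N + 1 + 1 by ring, prod_range_succ, prod_range_succ]
    ring_nf
  have a1 : qPochInv q (N + m) =
      (1 - q ^ 2 * q ^ (2 * N) * q ^ (2 * m)) * qPochInv q (N + 1 + m) := by
    rw [show (N : ℤ) + m = (N + 1 + m) - 1 by ring, qPochInv_sub_one hq]
    congr 2
    rw [← zpow_natCast, ← zpow_natCast, ← zpow_add₀ h0, ← zpow_add₀ h0]; congr 1; push_cast; ring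
  have a2 : qPochInv q (N + (m - 1)) =
      (1 - q ^ (2 * N) * q ^ (2 * m)) * qPochInv q (N + m) := by
    rw [show (N : ℤ) + (m - 1) = (N + m) - 1 by ring, qPochInv_sub_one hq]
    congr 2
    rw [← zpow_natCast, ← zpow_add₀ h0]; congr 1; push_cast; ring
  have b1 : qPochInv q (N - m) =
      (1 - q ^ 2 * q ^ (2 * N) * (q ^ (2 * m))⁻¹) * qPochInv q (N + 1 - m) := by
    rw [show (N : ℤ) - m = (N + 1 - m) - 1 by ring, qPochInv_sub_one hq, ← zpow_neg]
    congr 2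
    rw [← zpow_natCast, ← zpow_natCast, ← zpow_add₀ h0, ← zpow_add₀ h0]; congr 1; push_cast; ring
  have b2 : qPochInv q (N - (m + 1)) =
      (1 - q ^ (2 * N) * (q ^ (2 * m))⁻¹) * qPochInv q (N - m) := by
    rw [show (N : ℤ) - (m + 1) = (N - m) - 1 by ring, qPochInv_sub_one hq, ← zpow_neg]
    congr 2
    rw [← zpow_natCast, ← zpow_add₀ h0]; congr 1; push_cast; ring
  have c1 : qPochInv q (N + (m + 1)) = qPochInv q (N + 1 + m) := by congr 1; ring
  have c2 : qPochInv q (N - (m - 1)) = qPochInv q (N + 1 - m) := by congr 1; ring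
  simp only [tripleCoeff, e1, e2, s1, s2, p1, a2, b2, c1, c2, Nat.cast_add, Nat.cast_one, a1, b1]
  generalize q ^ (2 * m) = Y at *
  have e3 : q ^ (4 * N + 2) = (q ^ (2 * N)) ^ 2 * q ^ 2 := by ring
  have e4 : q ^ (2 * N + 2) = (q ^ (2 * N)) * q ^ 2 := by ring
  rw [e3, e4]
  generalize q ^ (2 * N) = X
  field_simp
  ring

theorem hasSum_tripleCoeff {q : ℂ} (h0 : q ≠ 0) (hq : ‖q‖ < 1) {x : ℂ} (hx : x ≠ 0) (N : ℕ) :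
    HasSum (fun m : ℤ => tripleCoeff q N m * x ^ m)
      (∏ i ∈ range N, ((1 - x * q ^ (2 * i)) * (1 - x⁻¹ * q ^ (2 * (i + 1))))) := by
  induction N with
  | zero =>
    have h := hasSum_single (f := fun m : ℤ => tripleCoeff q 0 m * x ^ m) 0 (by
      intro m hm
      rcases lt_or_gt_of_ne hm with h | h
      · simp [tripleCoeff, qPochInv, h.not_ge]
      · simp [tripleCoeff, qPochInv, h.not_ge])
    simpa [tripleCoeff, qPochInv, qPoch] using h
  | succ N ih =>
    rw [prod_range_succ]
    -- The terms of the new factor containing x and x⁻¹ shift the summation index by one.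
    have h1 := ((Equiv.subRight (1 : ℤ)).hasSum_iff).mpr ih
    have h2 := ((Equiv.addRight (1 : ℤ)).hasSum_iff).mpr ih
    have h := ((ih.mul_left (1 + q ^ (4 * N + 2))).sub (h1.mul_left (q ^ (2 * N) * x))).sub
      (h2.mul_left (q ^ (2 * N + 2) * x⁻¹))
    set P := ∏ i ∈ range N, ((1 - x * q ^ (2 * i)) * (1 - x⁻¹ * q ^ (2 * (i + 1))))
    have hv : P * ((1 - x * q ^ (2 * N)) * (1 - x⁻¹ * q ^ (2 * (N + 1)))) =
        (1 + q ^ (4 * N + 2)) * P - q ^ (2 * N) * x * P - q ^ (2 * N + 2) * x⁻¹ * P := by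
      field_simp
      ring
    rw [hv]
    refine Eq.mp (congrArg (HasSum · _ _) (funext fun m => ?_)) h
    simp only [Function.comp, Equiv.subRight_apply, Equiv.coe_addRight]
    rw [tripleCoeff_succ h0 hq, zpow_sub_one₀ hx, zpow_add_one₀ hx]
    field_simp

theorem exists_tendsto_qPoch {q : ℂ} (hq : ‖q‖ < 1) :
    ∃ L : ℂ, L ≠ 0 ∧ Tendsto (qPoch q) atTop (𝓝 L) := by
  have hs : Summable fun i : ℕ => ‖-q ^ (2 * (i + 1))‖ := by
    have : Summable fun i : ℕ => ‖q‖ ^ i := summable_geometric_of_lt_one (norm_nonneg _) hq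
    refine this.of_nonneg_of_le (fun _ => norm_nonneg _) fun i => ?_
    rw [norm_neg, norm_pow]
    exact pow_le_pow_of_le_one (norm_nonneg _) hq.le (by omega)
  refine ⟨_, tprod_one_add_ne_zero_of_summable (f := fun i : ℕ => -q ^ (2 * (i + 1)))
    (fun i => ?_) hs, ?_⟩
  · rw [← sub_eq_add_neg]; exact one_sub_pow_ne_zero hq (by positivity)
  · have := (multipliable_one_add_of_summable hs).tendsto_prod_tprod_nat
    simpa only [qPoch, sub_eq_add_neg] using! this

/-- No factor vanishes off q^{2ℤ} and the factors approach 1 geometrically, so the limit is nonzero.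
-/
theorem exists_tendsto_tripleProd {q : ℂ} (hq : ‖q‖ < 1) {x : ℂ}
    (hne : ∀ m : ℤ, x ≠ q ^ (2 * m)) :
    ∃ L : ℂ, L ≠ 0 ∧ Tendsto (fun N : ℕ =>
      ∏ i ∈ range N, ((1 - x * q ^ (2 * i)) * (1 - x⁻¹ * q ^ (2 * (i + 1))))) atTop (𝓝 L) := by
  have key : ∀ (y : ℂ) (k : ℕ), (∀ i : ℕ, y * q ^ (2 * (i + k)) ≠ 1) →
      ∃ L : ℂ, L ≠ 0 ∧ Tendsto (fun N : ℕ => ∏ i ∈ range N, (1 - y * q ^ (2 * (i + k)))) atTop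
        (𝓝 L) := by
    intro y k hy
    have hs : Summable fun i : ℕ => ‖-(y * q ^ (2 * (i + k)))‖ := by
      have : Summable fun i : ℕ => ‖y‖ * ‖q‖ ^ i :=
        (summable_geometric_of_lt_one (norm_nonneg _) hq).mul_left _
      refine this.of_nonneg_of_le (fun _ => norm_nonneg _) fun i => ?_
      rw [norm_neg, norm_mul, norm_pow]
      exact mul_le_mul_of_nonneg_left
        (pow_le_pow_of_le_one (norm_nonneg _) hq.le (by omega)) (norm_nonneg _)
    refine ⟨_, tprod_one_add_ne_zero_of_summable (f := fun i : ℕ => -(y * q ^ (2 * (i + k))))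
      (fun i => ?_) hs, ?_⟩
    · rw [← sub_eq_add_neg, sub_ne_zero]; exact (hy i).symm
    · have := (multipliable_one_add_of_summable hs).tendsto_prod_tprod_nat
      simpa only [sub_eq_add_neg] using! this
  obtain ⟨L₁, h1, t1⟩ := key x 0 fun i h => hne (-i) (by
    rw [show (2 * -(i : ℤ)) = -((2 * (i + 0) : ℕ) : ℤ) by push_cast; ring, zpow_neg, zpow_natCast]
    exact eq_inv_of_mul_eq_one_left h)
  obtain ⟨L₂, h2, t2⟩ := key x⁻¹ 1 fun i h => hne (i + 1) (by
    rw [show (2 * ((i : ℤ) + 1)) = ((2 * (i + 1) : ℕ) : ℤ) by push_cast; ring, zpow_natCast]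
    exact (eq_of_inv_mul_eq_one h))
  refine ⟨L₁ * L₂, mul_ne_zero h1 h2, ?_⟩
  simpa only [prod_mul_distrib, add_zero] using t1.mul t2

theorem tendsto_qPochInv {q : ℂ} {L : ℂ} (hL : L ≠ 0)
    (h : Tendsto (qPoch q) atTop (𝓝 L)) : Tendsto (qPochInv q) atTop (𝓝 L⁻¹) := by
  have h1 : Tendsto (fun k : ℤ => (qPoch q k.toNat)⁻¹) atTop (𝓝 L⁻¹) := by
    refine (h.comp ?_).inv₀ hL
    exact tendsto_atTop_atTop.mpr fun b => ⟨b, fun a ha => by omega⟩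
  refine h1.congr' ?_
  filter_upwards [eventually_ge_atTop 0] with k hk
  simp [qPochInv, hk]

theorem exists_norm_qPochInv_le {q : ℂ} {L : ℂ} (hL : L ≠ 0)
    (h : Tendsto (qPoch q) atTop (𝓝 L)) : ∃ C : ℝ, ∀ k, ‖qPochInv q k‖ ≤ C := by
  obtain ⟨C, hC⟩ := (h.inv₀ hL).norm.bddAbove_range
  refine ⟨max C 0, fun k => ?_⟩
  unfold qPochInv
  split_ifs
  · exact (hC ⟨k.toNat, rfl⟩).trans (le_max_left _ _)
  · simp

/-- The terms of the Jacobi theta series, normalized to vanish at `x = 1`. -/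
def thetaCoeff (q : ℂ) (m : ℤ) : ℂ := (-1) ^ m * q ^ (m * m - m)

/-- Let N → ∞ in the finite triple product. The Pochhammer symbols are bounded and tend to some L ≠
0, so by dominated convergence the infinite product equals L⁻¹ times the series. -/
theorem tsum_theta_ne_zero {q : ℂ} (h0 : q ≠ 0) (hq : ‖q‖ < 1) {x : ℂ} (hx : x ≠ 0)
    (hsum : Summable fun m : ℤ => ‖thetaCoeff q m * x ^ m‖)
    (hne : ∀ m : ℤ, x ≠ q ^ (2 * m)) : ∑' m : ℤ, thetaCoeff q m * x ^ m ≠ 0 := by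
  obtain ⟨L, hL, hLt⟩ := exists_tendsto_qPoch hq
  obtain ⟨P, hP, hPt⟩ := exists_tendsto_tripleProd hq hne
  obtain ⟨C, hC⟩ := exists_norm_qPochInv_le hL hLt
  obtain ⟨D, hD⟩ := hLt.norm.bddAbove_range
  have hC0 : 0 ≤ C := (norm_nonneg _).trans (hC 0)
  have hD0 : 0 ≤ D := (norm_nonneg _).trans (hD ⟨0, rfl⟩)
  have hlim : Tendsto (fun N : ℕ => ∑' m : ℤ, tripleCoeff q N m * x ^ m) atTop
      (𝓝 (∑' m : ℤ, (L * L⁻¹ * L⁻¹) * (thetaCoeff q m * x ^ m))) := by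
    refine tendsto_tsum_of_dominated_convergence (hsum.mul_left (D * C * C)) (fun m => ?_)
      (Eventually.of_forall fun N m => ?_)
    · have t1 : Tendsto (fun N : ℕ => qPoch q (2 * N)) atTop (𝓝 L) :=
        hLt.comp (tendsto_id.const_mul_atTop' (by norm_num))
      have hN : Tendsto (fun N : ℕ => (N : ℤ)) atTop atTop := tendsto_natCast_atTop_atTop
      have t2 : Tendsto (fun N : ℕ => qPochInv q (N + m)) atTop (𝓝 L⁻¹) :=
        (tendsto_qPochInv hL hLt).comp (tendsto_atTop_add_const_right _ m hN)
      have t3 : Tendsto (fun N : ℕ => qPochInv q (N - m)) atTop (𝓝 L⁻¹) :=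
        (tendsto_qPochInv hL hLt).comp (by
          simpa [sub_eq_add_neg] using tendsto_atTop_add_const_right _ (-m) hN)
      refine (((t1.mul t2).mul t3).mul_const (thetaCoeff q m * x ^ m)).congr fun N => ?_
      simp only [tripleCoeff, thetaCoeff]; ring
    · have : tripleCoeff q N m * x ^ m =
          qPoch q (2 * N) * qPochInv q (N + m) * qPochInv q (N - m) * (thetaCoeff q m * x ^ m) := by
        simp only [tripleCoeff, thetaCoeff]; ring
      rw [this, norm_mul, norm_mul, norm_mul]
      gcongr
      · exact hD ⟨_, rfl⟩
      · exact hC _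
      · exact hC _
  rw [tsum_mul_left] at hlim
  simp only [(hasSum_tripleCoeff h0 hq hx _).tsum_eq] at hlim
  intro h
  rw [h, mul_zero] at hlim
  exact hP (tendsto_nhds_unique hPt hlim)

/-- The involution m ↦ 1 - m preserves m² - m and reverses the sign (-1)^m. -/
theorem tsum_theta_one {q : ℂ} : ∑' m : ℤ, thetaCoeff q m * (1 : ℂ) ^ m = 0 := by
  have h := (Equiv.subLeft (1 : ℤ)).tsum_eq fun m : ℤ => thetaCoeff q m * (1 : ℂ) ^ m
  have h2 : ∀ m : ℤ, thetaCoeff q (1 - m) = -thetaCoeff q m := by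
    intro m
    rw [thetaCoeff, thetaCoeff, show (1 - m) * (1 - m) - (1 - m) = m * m - m by ring,
      sub_eq_add_neg, zpow_add₀ (by norm_num), zpow_neg, ← inv_zpow]
    norm_num
  simp only [Equiv.subLeft_apply, one_zpow, mul_one, h2, tsum_neg] at h ⊢
  exact self_eq_neg.mp h.symm

/-! ### Theta functions of higher degree and the Gaussian collocation matrix -/

theorem summable_exp_quadratic {c : ℝ} (hc : 0 < c) (u : ℝ) :
    Summable fun m : ℤ => Real.exp (-c * (m : ℝ) ^ 2 + u * m) := by
  have h := ((summable_jacobiTheta₂_term_iff (u / (2 * Real.pi * Complex.I))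
    (Complex.I * (c / Real.pi : ℝ))).mpr (by
      rw [Complex.I_mul_im, Complex.ofReal_re]; positivity)).norm
  refine h.congr fun m => ?_
  have hpi : (Real.pi : ℂ) ≠ 0 := by exact_mod_cast Real.pi_ne_zero
  have : (2 * Real.pi * Complex.I * m * (u / (2 * Real.pi * Complex.I)) +
      Real.pi * Complex.I * m ^ 2 * (Complex.I * (c / Real.pi : ℝ)) : ℂ) =
      ((-c * (m : ℝ) ^ 2 + u * m : ℝ) : ℂ) := by
    push_cast
    field_simp
    rw [Complex.I_sq]
    ring
  rw [jacobiTheta₂_term, this, Complex.norm_exp, Complex.ofReal_re]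

theorem summable_norm_thetaCoeff {c : ℝ} (hc : 0 < c) {x : ℂ} (hx : x ≠ 0) :
    Summable fun m : ℤ => ‖thetaCoeff (Complex.exp (-c)) m * x ^ m‖ := by
  refine (summable_exp_quadratic hc (c + Real.log ‖x‖)).congr fun m => ?_
  rw [thetaCoeff, norm_mul, norm_mul, norm_zpow, norm_zpow, norm_zpow, norm_neg, norm_one, one_zpow,
    one_mul, Complex.norm_exp, ← Real.rpow_intCast, ← Real.rpow_intCast ‖x‖, ← Real.exp_mul,
    Real.rpow_def_of_pos (norm_pos_iff.mpr hx), ← Real.exp_add, Complex.neg_re, Complex.ofReal_re]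
  congr 1
  push_cast
  ring

/-- Laurent coefficients of a theta function of degree `p`. -/
structure IsThetaSeq (q κ : ℂ) (p : ℕ) (e : ℤ → ℂ) : Prop where
  shift : ∀ n : ℤ, e (n + p) = κ * q ^ (2 * n + p) * e n
  summable : ∀ v : ℂ, v ≠ 0 → Summable fun n : ℤ => ‖e n * v ^ n‖

/-- Cauchy product of two-sided series, by the shear (n, m) ↦ (n - m, m) of ℤ × ℤ. -/
theorem laurent_mul {e t : ℤ → ℂ} {v : ℂ} (hv : v ≠ 0) (he : Summable fun n : ℤ => ‖e n * v ^ n‖)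
    (ht : Summable fun n : ℤ => ‖t n * v ^ n‖) :
    (Summable fun n : ℤ => ‖(∑' m : ℤ, e (n - m) * t m) * v ^ n‖) ∧
      ∑' n : ℤ, (∑' m : ℤ, e (n - m) * t m) * v ^ n =
        (∑' n : ℤ, e n * v ^ n) * ∑' n : ℤ, t n * v ^ n := by
  let σ : ℤ × ℤ ≃ ℤ × ℤ :=
    { toFun := fun z => (z.1 - z.2, z.2)
      invFun := fun z => (z.1 + z.2, z.2)
      left_inv := fun z => by simp
      right_inv := fun z => by simp }
  have hs : Summable fun z : ℤ × ℤ => ‖(e z.1 * v ^ z.1) * (t z.2 * v ^ z.2)‖ :=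
    Summable.mul_norm (f := fun n => e n * v ^ n) (g := fun n => t n * v ^ n) he ht
  have hs' := (σ.summable_iff).mpr hs
  have hterm : ∀ n m : ℤ, (e (n - m) * v ^ (n - m)) * (t m * v ^ m) = e (n - m) * t m * v ^ n := by
    intro n m
    rw [zpow_sub₀ hv]
    field_simp
  have hs2 : Summable fun z : ℤ × ℤ => ‖e (z.1 - z.2) * t z.2 * v ^ z.1‖ := by
    refine hs'.congr fun z => ?_
    simp only [Function.comp, σ, Equiv.coe_fn_mk, hterm]
  constructor
  · have h1 : Summable fun n : ℤ => ∑' m : ℤ, ‖e (n - m) * t m * v ^ n‖ := hs2.prod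
    refine h1.of_nonneg_of_le (fun _ => norm_nonneg _) fun n => ?_
    have h2 : Summable fun m : ℤ => ‖e (n - m) * t m * v ^ n‖ := hs2.prod_factor n
    have h3 := norm_tsum_le_tsum_norm h2
    rwa [tsum_mul_right] at h3
  · rw [tsum_mul_tsum_of_summable_norm he ht, ← σ.tsum_eq]
    have h1 : (fun z => (fun w : ℤ × ℤ => (e w.1 * v ^ w.1) * (t w.2 * v ^ w.2)) (σ z)) =
        fun z : ℤ × ℤ => e (z.1 - z.2) * t z.2 * v ^ z.1 := funext fun z => hterm z.1 z.2
    rw [h1, hs2.of_norm.tsum_prod]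
    exact tsum_congr fun n => tsum_mul_right.symm

/-- After m ↦ m + 1, a shift of n by p + 1 moves the index of e by p and that of t by 1, and the
exponents of q add up. -/
theorem IsThetaSeq.mul {q κ κ' : ℂ} (hq : q ≠ 0) {p : ℕ} {e t : ℤ → ℂ} (he : IsThetaSeq q κ p e)
    (ht : IsThetaSeq q κ' 1 t) :
    IsThetaSeq q (κ * κ') (p + 1) fun n => ∑' m : ℤ, e (n - m) * t m where
  shift n := by
    rw [← (Equiv.addRight (1 : ℤ)).tsum_eq, ← tsum_mul_left]
    refine tsum_congr fun m => ?_
    have h1 := ht.shift m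
    rw [Nat.cast_one] at h1
    rw [Equiv.coe_addRight, h1,
      show n + ((p + 1 : ℕ) : ℤ) - (m + 1) = (n - m) + p by push_cast; ring, he.shift,
      show 2 * n + ((p + 1 : ℕ) : ℤ) = (2 * (n - m) + p) + (2 * m + 1) by push_cast; ring,
      zpow_add₀ hq (2 * (n - m) + p)]
    generalize q ^ (2 * (n - m) + (p : ℤ)) = A, q ^ (2 * m + 1) = B
    ring
  summable v hv := (laurent_mul hv (he.summable v hv) (ht.summable v hv)).1

theorem isThetaSeq_theta {c : ℝ} (hc : 0 < c) {w : ℂ} (hw : w ≠ 0) :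
    IsThetaSeq (Complex.exp (-c)) (-(Complex.exp (-c) * w)⁻¹) 1
      fun m => thetaCoeff (Complex.exp (-c)) m * w⁻¹ ^ m where
  shift n := by
    have hq : Complex.exp (-c) ≠ 0 := Complex.exp_ne_zero _
    generalize Complex.exp (-c) = q at *
    simp only [thetaCoeff, Nat.cast_one]
    rw [zpow_add_one₀ (by norm_num), zpow_add_one₀ (inv_ne_zero hw),
      show (n + 1) * (n + 1) - (n + 1) = (n * n - n) + 2 * n by ring, zpow_add₀ hq,
      zpow_add_one₀ hq]
    field_simp
  summable v hv := by
    refine (summable_norm_thetaCoeff hc (mul_ne_zero (inv_ne_zero hw) hv)).congr fun m => ?_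
    rw [mul_zpow, mul_assoc]

/-- The theta function of degree one vanishing at `x = 1`. -/
def theta (q x : ℂ) : ℂ := ∑' m : ℤ, thetaCoeff q m * x ^ m

theorem exists_isThetaSeq_prod {c : ℝ} (hc : 0 < c) {ι : Type*} (S : Finset ι) (w : ι → ℂ)
    (hw : ∀ i, w i ≠ 0) :
    ∃ e : ℤ → ℂ, IsThetaSeq (Complex.exp (-c)) (∏ i ∈ S, -(Complex.exp (-c) * w i)⁻¹) #S e ∧
      ∀ v : ℂ, v ≠ 0 → ∑' n : ℤ, e n * v ^ n = ∏ i ∈ S, theta (Complex.exp (-c)) ((w i)⁻¹ * v) := by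
  classical
  induction S using Finset.induction_on with
  | empty =>
    -- The constant function 1 has degree 0: its only coefficient sits at n = 0, where q^{2n} = 1.
    refine ⟨Pi.single 0 1, ⟨fun n => ?_, fun v _ => ?_⟩, fun v _ => ?_⟩
    · rcases eq_or_ne n 0 with rfl | hn <;> simp [*]
    · refine summable_of_ne_finset_zero (s := {0}) fun n hn => ?_
      simp only [mem_singleton] at hn
      simp [hn]
    · rw [tsum_eq_single 0 (fun n hn => by simp [hn])]
      simp
  | insert i S hi ih =>
    obtain ⟨e, he, hev⟩ := ih
    have ht := isThetaSeq_theta hc (hw i)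
    refine ⟨_, ?_, fun v hv =>
      (laurent_mul hv (he.summable v hv) (ht.summable v hv)).2.trans ?_⟩
    · rw [card_insert_of_notMem hi, prod_insert hi, mul_comm]
      exact he.mul (Complex.exp_ne_zero _) ht
    · rw [prod_insert hi, mul_comm, ← hev v hv]
      congr 1
      exact tsum_congr fun m => by rw [mul_zpow, mul_assoc]

theorem IsThetaSeq.apply_add_mul {q κ : ℂ} (hq : q ≠ 0) (hκ : κ ≠ 0) {p : ℕ} {e : ℤ → ℂ}
    (he : IsThetaSeq q κ p e) (s j : ℤ) :
    e (s + p * j) = κ ^ j * q ^ (2 * s * j + p * j * j) * e s := by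
  induction j with
  | zero => simp
  | succ n ih =>
    rw [show s + (p : ℤ) * ((n : ℤ) + 1) = (s + p * n) + p by ring, he.shift, ih,
      zpow_add_one₀ hκ, show 2 * s * ((n : ℤ) + 1) + p * (n + 1) * (n + 1) =
        (2 * (s + p * n) + p) + (2 * s * n + p * n * n) by ring, zpow_add₀ hq _ (2 * s * n + _)]
    ring
  | pred n ih =>
    have h := he.shift (s + p * (-(n : ℤ) - 1))
    rw [show s + (p : ℤ) * (-(n : ℤ) - 1) + p = s + p * (-n) by ring, ih] at h
    have h2 : e (s + p * (-(n : ℤ) - 1)) = κ⁻¹ *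
        (q ^ (2 * (s + (p : ℤ) * (-(n : ℤ) - 1)) + p))⁻¹ *
        (κ ^ (-(n : ℤ)) * q ^ (2 * s * (-n) + p * (-n) * (-n)) * e s) := by
      rw [h]
      have := zpow_ne_zero (2 * (s + (p : ℤ) * (-(n : ℤ) - 1)) + p) hq
      field_simp
    rw [h2, zpow_sub_one₀ hκ, ← zpow_neg, show 2 * s * (-(n : ℤ) - 1) + p * (-n - 1) * (-n - 1) =
      -(2 * (s + (p : ℤ) * (-(n : ℤ) - 1)) + p) + (2 * s * (-n) + p * (-n) * (-n)) by ring,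
      zpow_add₀ hq _ (2 * s * (-n) + _)]
    ring

theorem tsum_int_eq_sum_tsum {p : ℕ} [NeZero p] {f : ℤ → ℂ} (hf : Summable f) :
    ∑' n : ℤ, f n = ∑ s : Fin p, ∑' j : ℤ, f ((s : ℕ) + p * j) := by
  let φ : Fin p × ℤ ≃ ℤ := (Equiv.prodComm _ _).trans (Int.divModEquiv p).symm
  have hφ : ∀ z, φ z = (z.1 : ℕ) + p * z.2 := fun z => by
    simp [φ, Int.divModEquiv]; ring
  have hs := (φ.summable_iff).mpr hf
  rw [← φ.tsum_eq]
  refine hs.tsum_prod.trans ?_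
  rw [tsum_fintype]
  simp only [hφ, Function.comp]

/-- The entries of the Gaussian collocation matrix, periodized with multiplier `κ`. -/
def gaussEntry (γ : ℝ) (p : ℕ) (κ : ℂ) (x : ℝ) : ℂ :=
  ∑' j : ℤ, Complex.exp (-γ * (x + p * j) ^ 2) * κ ^ j

/-- A theta function of degree `p`, sampled at `exp (2γy)`, is a combination of the columns of the
Gaussian collocation matrix. -/
theorem IsThetaSeq.sum_gaussEntry {γ : ℝ} {p : ℕ} [NeZero p] {κ : ℂ} (hκ : κ ≠ 0) {e : ℤ → ℂ}
    (he : IsThetaSeq (Complex.exp (-(γ * p : ℝ))) κ p e) (y : ℝ) :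
    ∑ s : Fin p, gaussEntry γ p κ ((s : ℕ) - y) * (e (s : ℕ) * Complex.exp (γ * (s : ℕ) ^ 2)) =
      Complex.exp (-γ * y ^ 2) * ∑' n : ℤ, e n * Complex.exp (2 * γ * y) ^ n := by
  rw [tsum_int_eq_sum_tsum (p := p) (he.summable _ (Complex.exp_ne_zero _)).of_norm, mul_sum]
  refine sum_congr rfl fun s _ => ?_
  rw [gaussEntry, ← tsum_mul_right, ← tsum_mul_left]
  refine tsum_congr fun j => ?_
  rw [he.apply_add_mul (Complex.exp_ne_zero _) hκ, ← Complex.exp_int_mul, ← Complex.exp_int_mul]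
  -- Expanding the square in s + pj - y: the cross term of s and pj and the square of pj give the
  -- power of q = e^{-γp} from `apply_add_mul`, and the cross term with y gives the power of
  -- e^{2γy}.
  have h : Complex.exp (-γ * (((s : ℕ) - y : ℝ) + p * j) ^ 2) * Complex.exp (γ * (s : ℕ) ^ 2) =
      Complex.exp (-γ * y ^ 2) * (Complex.exp ((2 * (s : ℕ) * j + p * j * j : ℤ) * -(γ * p : ℝ)) *
        Complex.exp (((s : ℕ) + p * j : ℤ) * (2 * γ * y))) := by
    simp only [← Complex.exp_add]
    congr 1
    push_cast
    ring
  linear_combination (κ ^ j * e (s : ℕ)) * h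

theorem theta_one (q : ℂ) : theta q 1 = 0 := tsum_theta_one

theorem theta_ne_zero {c : ℝ} (hc : 0 < c) {x : ℂ} (hx : x ≠ 0)
    (hne : ∀ m : ℤ, x ≠ Complex.exp (2 * m * -c)) : theta (Complex.exp (-c)) x ≠ 0 := by
  refine tsum_theta_ne_zero (Complex.exp_ne_zero _) ?_ hx (summable_norm_thetaCoeff hc hx) ?_
  · rw [Complex.norm_exp]; simpa using hc
  · intro m h
    refine hne m (h.trans ?_)
    rw [← Complex.exp_int_mul]
    push_cast
    rfl

/-- The Gaussian collocation matrix at points that are distinct modulo `p` is invertible when the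
multiplier is not real. -/
theorem det_gaussEntry_ne_zero {γ : ℝ} (hγ : 0 < γ) {p : ℕ} (y : Fin p → ℝ)
    (hy : ∀ r s : Fin p, ∀ m : ℤ, y r - y s = p * m → r = s) {κ : ℂ} (hκ : κ.im ≠ 0) :
    (Matrix.of fun r s : Fin p => gaussEntry γ p κ ((s : ℕ) - y r)).det ≠ 0 := by
  rcases Nat.eq_zero_or_pos p with rfl | hp
  · simp
  have : NeZero p := ⟨hp.ne'⟩
  have hκ0 : κ ≠ 0 := fun h => hκ (by simp [h])
  have hc : 0 < γ * p := by positivity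
  set q := Complex.exp (-(γ * p : ℝ)) with hq
  have hq0 : q ≠ 0 := Complex.exp_ne_zero _
  let v : Fin p → ℂ := fun r => Complex.exp (2 * γ * y r)
  have hv : ∀ r, v r ≠ 0 := fun r => Complex.exp_ne_zero _
  -- The k-th theta function is to vanish at `v r` for r ≠ k and at `w k`. Multiplier κ forces the
  -- product of its p chosen zeros to be (-q⁻¹)^p κ⁻¹, which determines `w k`.
  let w : Fin p → ℂ := fun k => (-q⁻¹) ^ p * κ⁻¹ * (∏ r, (v r)⁻¹) * v k
  have hw : ∀ k, w k ≠ 0 := fun k => by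
    refine mul_ne_zero (mul_ne_zero (mul_ne_zero ?_ (inv_ne_zero hκ0)) ?_) (hv k)
    · exact pow_ne_zero _ (neg_ne_zero.mpr (inv_ne_zero hq0))
    · exact prod_ne_zero_iff.mpr fun r _ => inv_ne_zero (hv r)
  have hW : ∀ k, ∃ e : ℤ → ℂ, IsThetaSeq q κ p e ∧ ∀ r, (∑' n : ℤ, e n * v r ^ n = 0 ↔ r ≠ k) := by
    intro k
    let u : Fin p → ℂ := Function.update v k (w k)
    have hu : ∀ r, u r ≠ 0 := fun r => by
      rcases eq_or_ne r k with rfl | h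
      · simpa [u] using hw r
      · simpa [u, h] using hv r
    obtain ⟨e, he, hev⟩ := exists_isThetaSeq_prod hc univ u hu
    refine ⟨e, ?_, fun r => ?_⟩
    · have hk : ∏ i, -(q * u i)⁻¹ = κ := by
        have h1 : ∏ i, -(q * u i)⁻¹ = (-q⁻¹) ^ p * (∏ i, u i)⁻¹ := by
          rw [← prod_inv_distrib, ← Fin.prod_const, ← prod_mul_distrib]
          exact prod_congr rfl fun i _ => by rw [mul_inv]; ring
        have h2 : ∏ i, v i = v k * ∏ i ∈ univ \ {k}, v i := by
          rw [← prod_sdiff (subset_univ {k}), prod_singleton, mul_comm]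
        have h3 : ∏ i ∈ univ \ {k}, v i ≠ 0 := prod_ne_zero_iff.mpr fun i _ => hv i
        have h4 : ((-q⁻¹) ^ p) ≠ 0 := pow_ne_zero _ (neg_ne_zero.mpr (inv_ne_zero hq0))
        have h5 := hv k
        rw [h1, prod_update_of_mem (mem_univ k)]
        simp only [w, prod_inv_distrib]
        rw [h2]
        generalize ((-q⁻¹) ^ p) = Z at *
        field_simp
      rw [hk, card_univ, Fintype.card_fin] at he
      exact he
    · rw [hev _ (hv r), prod_eq_zero_iff]
      constructor
      · rintro ⟨i, -, hi⟩ rfl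
        refine theta_ne_zero hc (mul_ne_zero (inv_ne_zero (hu i)) (hv r)) (fun m h => ?_) hi
        rcases eq_or_ne i r with rfl | hir
        -- Apart from κ, all factors of the quotient of `v i` by `w i` are real, so a zero at `v i`
        -- would make κ real.
        · obtain ⟨ρ, hρ⟩ : ∃ ρ : ℝ, (ρ : ℂ) = (-q⁻¹) ^ p * ∏ r, (v r)⁻¹ :=
            ⟨(-(Real.exp (-(γ * p)))⁻¹) ^ p * ∏ r, (Real.exp (2 * γ * y r))⁻¹, by
              simp [hq, v]⟩
          have h1 : κ = Complex.exp (2 * m * -(γ * p : ℝ)) * ρ := by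
            rw [← h]
            simp only [u, Function.update_self, w]
            rw [mul_right_comm ((-q⁻¹) ^ p), ← hρ]
            have : (ρ : ℂ) ≠ 0 := by
              rw [hρ]
              exact mul_ne_zero (pow_ne_zero _ (neg_ne_zero.mpr (inv_ne_zero hq0)))
                (prod_ne_zero_iff.mpr fun r _ => inv_ne_zero (hv r))
            have := hv i
            field_simp
          rw [show (2 * m * -(γ * p : ℝ) : ℂ) = ((2 * m * -(γ * p) : ℝ) : ℂ) by push_cast; ring,
            ← Complex.ofReal_exp, ← Complex.ofReal_mul] at h1
          exact hκ (by rw [h1, Complex.ofReal_im])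
        -- For the other zeros, a coincidence modulo q^{2ℤ} is a coincidence of the points y modulo
        -- p.
        · simp only [u, Function.update_of_ne hir, v] at h
          rw [← Complex.exp_neg, ← Complex.exp_add] at h
          have h1 : Real.exp (-(2 * γ * y i) + 2 * γ * y r) = Real.exp (2 * m * -(γ * p)) := by
            exact_mod_cast h
          have h2 := Real.exp_injective h1
          refine hir (hy r i (-m) ?_).symm
          push_cast
          have h3 : γ * (y r - y i) = γ * (p * -m) := by linear_combination h2 / 2
          exact mul_left_cancel₀ hγ.ne' h3
      · intro hr
        refine ⟨r, mem_univ _, ?_⟩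
        simp only [u, Function.update_of_ne hr, inv_mul_cancel₀ (hv r), theta_one]
  choose e he hev using hW
  intro hdet
  let A := Matrix.of fun r s : Fin p => gaussEntry γ p κ ((s : ℕ) - y r)
  let B := Matrix.of fun s k : Fin p => e k (s : ℕ) * Complex.exp (γ * (s : ℕ) ^ 2)
  have hAB : A * B = Matrix.diagonal fun k =>
      Complex.exp (-γ * y k ^ 2) * ∑' n : ℤ, e k n * v k ^ n := by
    ext r k
    rw [Matrix.mul_apply]
    simp only [A, B, Matrix.of_apply]
    rw [(he k).sum_gaussEntry hκ0]
    rcases eq_or_ne r k with rfl | h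
    · simp [v]
    · rw [Matrix.diagonal_apply_ne _ h, (hev k r).mpr h, mul_zero]
  have h := congrArg Matrix.det hAB
  rw [Matrix.det_mul, hdet, zero_mul, Matrix.det_diagonal] at h
  obtain ⟨k, -, hk⟩ := prod_eq_zero_iff.mp h.symm
  exact (hev k k).mp ((mul_eq_zero.mp hk).resolve_left (Complex.exp_ne_zero _)) rfl

/-! ### The window and its periodizations -/

/-- The function `e^{-γξ²} ∏ (1 + 2πiδ_jξ)⁻¹` on the complex plane. -/
def window {M : ℕ} (γ : ℝ) (δ : Fin M → ℝ) (ξ : ℂ) : ℂ :=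
  Complex.exp (-γ * ξ ^ 2) * ∏ j, (1 + 2 * Real.pi * Complex.I * δ j * ξ)⁻¹

/-- With a = Re ξ, (a + y)² ≥ y²/2 - a²: half of the Gaussian decay in y survives a bounded complex
shift. -/
theorem norm_exp_neg_sq_le {γ : ℝ} (hγ : 0 < γ) (ξ : ℂ) (y : ℝ) :
    ‖Complex.exp (-γ * (ξ + y) ^ 2)‖ ≤ Real.exp (γ * ‖ξ‖ ^ 2) * Real.exp (-(γ / 2) * y ^ 2) := by
  rw [Complex.norm_exp, ← Real.exp_add]
  refine Real.exp_le_exp.mpr ?_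
  have h1 : (-γ * (ξ + y) ^ 2 : ℂ).re = -γ * ((ξ.re + y) ^ 2 - ξ.im ^ 2) := by
    rw [← Complex.ofReal_neg, Complex.re_ofReal_mul, sq, Complex.mul_re]
    simp only [Complex.add_re, Complex.add_im, Complex.ofReal_re, Complex.ofReal_im, add_zero]
    ring
  have h2 : ‖ξ‖ ^ 2 = ξ.re ^ 2 + ξ.im ^ 2 := by rw [Complex.sq_norm, Complex.normSq_apply]; ring
  rw [h1, h2]
  nlinarith [mul_nonneg hγ.le (sq_nonneg (2 * ξ.re + y))]

theorem norm_window_le {M : ℕ} {γ : ℝ} (hγ : 0 < γ) {δ : Fin M → ℝ} {ξ : ℂ} {y : ℝ} {ε : Fin M → ℝ}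
    (hε : ∀ j, 0 < ε j) (h : ∀ j, ε j ≤ ‖1 + 2 * Real.pi * Complex.I * δ j * (ξ + y)‖) {R : ℝ}
    (hR : ‖ξ‖ ≤ R) :
    ‖window γ δ (ξ + y)‖ ≤
      (∏ j, (ε j)⁻¹) * Real.exp (γ * R ^ 2) * Real.exp (-(γ / 2) * y ^ 2) := by
  rw [window, norm_mul, norm_prod, mul_comm, mul_assoc (∏ j, (ε j)⁻¹)]
  refine mul_le_mul (prod_le_prod (fun _ _ => norm_nonneg _) fun j _ => ?_)
    ((norm_exp_neg_sq_le hγ ξ y).trans ?_) (norm_nonneg _)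
    (prod_nonneg fun j _ => (inv_pos.mpr (hε j)).le)
  · rw [norm_inv]
    exact inv_anti₀ (hε j) (h j)
  · gcongr

theorem one_le_norm_linear (d x : ℝ) : 1 ≤ ‖1 + 2 * Real.pi * Complex.I * d * (x : ℂ)‖ := by
  have h : (1 + 2 * Real.pi * Complex.I * d * (x : ℂ)).re = 1 := by
    simp
  calc (1 : ℝ) = |(1 + 2 * Real.pi * Complex.I * d * (x : ℂ)).re| := by rw [h, abs_one]
    _ ≤ _ := Complex.abs_re_le_norm _

theorem norm_window_ofReal_le {M : ℕ} {γ : ℝ} (hγ : 0 < γ) (δ : Fin M → ℝ) {x y R : ℝ}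
    (hR : |x| ≤ R) : ‖window γ δ ((x : ℂ) + y)‖ ≤
      Real.exp (γ * R ^ 2) * Real.exp (-(γ / 2) * y ^ 2) := by
  have h := norm_window_le (δ := δ) (ξ := x) (y := y) hγ (ε := fun _ => 1) (fun _ => one_pos)
    (fun j => by
      rw [← Complex.ofReal_add]; exact one_le_norm_linear _ _) (R := R) (by simpa using hR)
  simpa using h

theorem summable_gauss {γ : ℝ} (hγ : 0 < γ) {p : ℕ} (hp : p ≠ 0) :
    Summable fun j : ℤ => Real.exp (-(γ / 2) * ((p : ℝ) * j) ^ 2) := by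
  have hc : 0 < γ / 2 * p ^ 2 := by positivity
  refine (summable_exp_quadratic hc 0).congr fun j => ?_
  congr 1
  ring

/-- The `p`-periodization of the window, with character `x`. -/
def windowEntry {M : ℕ} (γ : ℝ) (δ : Fin M → ℝ) (p : ℕ) (ξ : ℂ) (x : UnitAddCircle) : ℂ :=
  ∑' j : ℤ, window γ δ (ξ + ((p * j : ℝ) : ℂ)) * fourier j x

theorem norm_fourier_apply (j : ℤ) (x : UnitAddCircle) : ‖fourier j x‖ = 1 := by
  rw [fourier_apply]; exact Circle.norm_coe _

theorem continuous_window {M : ℕ} (γ : ℝ) (δ : Fin M → ℝ) :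
    Continuous fun x : ℝ => window γ δ x := by
  unfold window
  refine Continuous.mul (by fun_prop) (continuous_finsetProd _ fun j _ => ?_)
  refine Continuous.inv₀ (by fun_prop) fun x h => ?_
  have := one_le_norm_linear (δ j) x
  rw [h, norm_zero] at this
  linarith

/-- Joint continuity supplies the measurability needed to exchange the quantifiers over ξ and x. -/
theorem continuous_windowEntry {M : ℕ} {γ : ℝ} (hγ : 0 < γ) (δ : Fin M → ℝ) {p : ℕ} (hp : p ≠ 0) :
    Continuous fun z : ℝ × UnitAddCircle => windowEntry γ δ p z.1 z.2 := by
  rw [continuous_iff_continuousAt]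
  intro z
  have hU : {w : ℝ × UnitAddCircle | |w.1| < |z.1| + 1} ∈ 𝓝 z :=
    (isOpen_lt (by fun_prop) (by fun_prop)).mem_nhds (by simp)
  refine ContinuousOn.continuousAt ?_ hU
  refine continuousOn_tsum (fun j => Continuous.continuousOn ?_)
    ((summable_gauss hγ hp).mul_left (Real.exp (γ * (|z.1| + 1) ^ 2))) fun j w hw => ?_
  · refine Continuous.mul ?_ ((fourier j).continuous.comp continuous_snd)
    simp_rw [← Complex.ofReal_add]
    exact (continuous_window γ δ).comp (by fun_prop)
  · rw [norm_mul, norm_fourier_apply, mul_one]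
    exact norm_window_ofReal_le hγ δ (le_of_lt hw)

/-- The poles of the window, translated by `(1/q)ℤ`. -/
def polarSet {M : ℕ} (δ : Fin M → ℝ) (q : ℕ) : Set ℂ :=
  ⋃ j : Fin M, ⋃ _ : δ j ≠ 0, Set.range fun n : ℤ => Complex.I / (2 * Real.pi * δ j) - n / q

theorem countable_polarSet {M : ℕ} (δ : Fin M → ℝ) (q : ℕ) : (polarSet δ q).Countable :=
  Set.countable_iUnion fun _ => Set.countable_iUnion fun _ => Set.countable_range _

theorem isClosed_polarSet {M : ℕ} (δ : Fin M → ℝ) {q : ℕ} (hq : q ≠ 0) :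
    IsClosed (polarSet δ q) := by
  refine isClosed_iUnion_of_finite fun j => isClosed_iUnion_of_finite fun _ => ?_
  have hq' : (0 : ℝ) < q := by positivity
  refine Metric.isClosed_of_pairwise_le_dist (ε := 1 / q) (by positivity) ?_
  rintro _ ⟨m, rfl⟩ _ ⟨n, rfl⟩ hmn
  have hne : m ≠ n := fun h => hmn (by rw [h])
  rw [dist_eq_norm, sub_sub_sub_cancel_left, ← sub_div, norm_div, Complex.norm_natCast]
  gcongr
  have h1 : (1 : ℤ) ≤ |n - m| := Int.one_le_abs (sub_ne_zero.mpr hne.symm)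
  calc (1 : ℝ) ≤ ((|n - m| : ℤ) : ℝ) := by exact_mod_cast h1
    _ = ‖((n - m : ℤ) : ℂ)‖ := by rw [Complex.norm_intCast, Int.cast_abs]
    _ = _ := by push_cast; rfl

/-- When δⱼ ≠ 0, the linear factor is 2πiδⱼ times the difference between ξ and a point of the polar
set. -/
theorem le_norm_linear_of_le_dist {M : ℕ} {δ : Fin M → ℝ} {q : ℕ} {ξ : ℂ} {ρ : ℝ}
    (h : ∀ z ∈ polarSet δ q, ρ ≤ dist ξ z) (j : Fin M) (n : ℤ) :
    (if δ j = 0 then 1 else 2 * Real.pi * |δ j| * ρ) ≤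
      ‖1 + 2 * Real.pi * Complex.I * δ j * (ξ + ((n / q : ℝ) : ℂ))‖ := by
  split_ifs with hδ
  · simp [hδ]
  · have h1 := h (Complex.I / (2 * Real.pi * δ j) - n / q)
      (Set.mem_iUnion.mpr ⟨j, Set.mem_iUnion.mpr ⟨hδ, n, rfl⟩⟩)
    have hpi : (Real.pi : ℂ) ≠ 0 := by exact_mod_cast Real.pi_ne_zero
    have hδ' : (δ j : ℂ) ≠ 0 := by exact_mod_cast hδ
    have h2 : 1 + 2 * Real.pi * Complex.I * δ j * (ξ + ((n / q : ℝ) : ℂ)) =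
        2 * Real.pi * Complex.I * δ j * (ξ - (Complex.I / (2 * Real.pi * δ j) - n / q)) := by
      push_cast
      have : Complex.I * Complex.I = -1 := Complex.I_mul_I
      have h3 : 2 * Real.pi * Complex.I * δ j * (Complex.I / (2 * Real.pi * δ j)) = -1 := by
        field_simp
        linear_combination this
      linear_combination h3
    rw [h2, norm_mul, ← dist_eq_norm]
    have h4 : ‖(2 * Real.pi * Complex.I * δ j : ℂ)‖ = 2 * Real.pi * |δ j| := by
      simp [abs_of_pos Real.pi_pos]
    rw [h4]
    gcongr

/-- On a ball of half the radius of a pole-free ball, the linear factors are bounded below uniformly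
in the summation index, so the Gaussian bound gives uniform convergence. -/
theorem differentiableOn_windowEntry {M : ℕ} {γ : ℝ} (hγ : 0 < γ) (δ : Fin M → ℝ) {p q : ℕ}
    (hp : p ≠ 0) (hq : q ≠ 0) (x : UnitAddCircle) (k : ℤ) :
    DifferentiableOn ℂ (fun ξ => windowEntry γ δ p (ξ + ((k / q : ℝ) : ℂ)) x) (polarSet δ q)ᶜ := by
  intro ξ₀ hξ₀
  obtain ⟨r, hr, hball⟩ := Metric.isOpen_iff.mp (isClosed_polarSet δ hq).isOpen_compl ξ₀ hξ₀
  have hr2 : 0 < r / 2 := by positivity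
  let ε : Fin M → ℝ := fun j => if δ j = 0 then 1 else 2 * Real.pi * |δ j| * (r / 2)
  have hε : ∀ j, 0 < ε j := fun j => by
    simp only [ε]
    split_ifs with h
    · exact one_pos
    · have := abs_pos.mpr h
      have := Real.pi_pos
      positivity
  have hdist : ∀ ξ ∈ Metric.ball ξ₀ (r / 2), ∀ z ∈ polarSet δ q, r / 2 ≤ dist ξ z := by
    intro ξ hξ z hz
    by_contra! hlt
    refine hball (a := z) ?_ hz
    rw [Metric.mem_ball] at hξ ⊢
    calc dist z ξ₀ ≤ dist z ξ + dist ξ ξ₀ := dist_triangle _ _ _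
      _ < r := by rw [dist_comm z]; linarith
  have hlow : ∀ ξ ∈ Metric.ball ξ₀ (r / 2), ∀ (i : ℤ) (j : Fin M),
      ε j ≤ ‖1 + 2 * Real.pi * Complex.I * δ j *
        (ξ + ((k / q : ℝ) : ℂ) + ((p * i : ℝ) : ℂ))‖ := by
    intro ξ hξ i j
    have h := le_norm_linear_of_le_dist (hdist ξ hξ) j (k + q * p * i)
    refine h.trans_eq ?_
    have : ((((k + q * p * i : ℤ) : ℝ) / q : ℝ) : ℂ) = ((k / q : ℝ) : ℂ) + ((p * i : ℝ) : ℂ) := by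
      have : (q : ℂ) ≠ 0 := by exact_mod_cast hq
      push_cast
      field_simp
    rw [this, add_assoc]
  refine DifferentiableAt.differentiableWithinAt ?_
  refine DifferentiableOn.differentiableAt (s := Metric.ball ξ₀ (r / 2)) ?_
    (Metric.ball_mem_nhds _ hr2)
  refine Complex.differentiableOn_tsum_of_summable_norm
    (u := fun i : ℤ => ((∏ j, (ε j)⁻¹) *
      Real.exp (γ * (‖ξ₀‖ + r / 2 + ‖((k / q : ℝ) : ℂ)‖) ^ 2)) *
        Real.exp (-(γ / 2) * ((p : ℝ) * i) ^ 2)) ((summable_gauss hγ hp).mul_left _)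
    (fun i => ?_) Metric.isOpen_ball fun i ξ hξ => ?_
  · refine DifferentiableOn.mul_const (DifferentiableOn.mul ?_ ?_) _
    · fun_prop
    · refine DifferentiableOn.fun_finsetProd fun j _ => DifferentiableOn.fun_inv (by fun_prop) ?_
      intro ξ hξ h
      have := hlow ξ hξ i j
      rw [h, norm_zero] at this
      exact absurd (hε j) this.not_gt
  · rw [norm_mul, norm_fourier_apply, mul_one]
    refine norm_window_le hγ hε (hlow ξ hξ i) ((norm_add_le _ _).trans ?_)
    rw [Metric.mem_ball, dist_eq_norm] at hξ
    have : ‖ξ‖ ≤ ‖ξ₀‖ + ‖ξ - ξ₀‖ := by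
      simpa using norm_add_le ξ₀ (ξ - ξ₀)
    linarith

/-! ### Generic invertibility of the window matrix -/

/-- The ratio of the rational factor of the window at `it + y` and at `it`. -/
def damping {M : ℕ} (δ : Fin M → ℝ) (t y : ℝ) : ℂ :=
  ∏ j, ((1 - 2 * Real.pi * δ j * t : ℝ) : ℂ) /
    ((1 - 2 * Real.pi * δ j * t : ℝ) + (2 * Real.pi * δ j * y : ℝ) * Complex.I)

/-- In each factor the numerator is the real part of the denominator. -/
theorem norm_damping_le {M : ℕ} (δ : Fin M → ℝ) (t y : ℝ) : ‖damping δ t y‖ ≤ 1 := by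
  rw [damping, norm_prod]
  refine prod_le_one (fun _ _ => norm_nonneg _) fun j _ => ?_
  rw [norm_div]
  refine div_le_one_of_le₀ ?_ (norm_nonneg _)
  calc ‖((1 - 2 * Real.pi * δ j * t : ℝ) : ℂ)‖ =
        |(((1 - 2 * Real.pi * δ j * t : ℝ) : ℂ) + (2 * Real.pi * δ j * y : ℝ) * Complex.I).re| := by
        rw [Complex.norm_real, Complex.add_re, Complex.re_ofReal_mul, Complex.I_re, mul_zero,
          add_zero, Complex.ofReal_re, Real.norm_eq_abs]
    _ ≤ _ := Complex.abs_re_le_norm _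

theorem tendsto_inv_linear {d : ℝ} (hd : d ≠ 0) :
    Tendsto (fun t : ℝ => (1 - 2 * Real.pi * d * t)⁻¹) atTop (𝓝 0) := by
  have hpi := Real.pi_pos
  rcases lt_or_gt_of_ne hd with h | h
  · refine tendsto_inv_atTop_zero.comp ?_
    have : Tendsto (fun t : ℝ => 1 + (-(2 * Real.pi * d)) * t) atTop atTop :=
      tendsto_atTop_add_const_left _ _ (tendsto_id.const_mul_atTop (by nlinarith))
    exact this.congr fun t => by ring
  · refine tendsto_inv_atBot_zero.comp ?_
    have : Tendsto (fun t : ℝ => 1 + (-(2 * Real.pi * d)) * t) atTop atBot :=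
      tendsto_atBot_add_const_left _ _ (tendsto_id.const_mul_atTop_of_neg (by nlinarith))
    exact this.congr fun t => by ring

theorem eventually_linear_ne_zero (d : ℝ) : ∀ᶠ t : ℝ in atTop, 1 - 2 * Real.pi * d * t ≠ 0 := by
  have hpi := Real.pi_pos
  rcases le_or_gt d 0 with h | h
  · filter_upwards [eventually_ge_atTop 0] with t ht
    have : 0 ≤ 2 * Real.pi * (-d) * t := by
      have : 0 ≤ -d := by linarith
      positivity
    linarith
  · filter_upwards [eventually_gt_atTop (1 / (2 * Real.pi * d))] with t ht
    rw [div_lt_iff₀ (by positivity)] at ht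
    linarith

theorem tendsto_damping {M : ℕ} (δ : Fin M → ℝ) (y : ℝ) :
    Tendsto (fun t => damping δ t y) atTop (𝓝 1) := by
  have : (1 : ℂ) = ∏ _j : Fin M, 1 := by simp
  rw [this]
  refine tendsto_finsetProd _ fun j _ => ?_
  rcases eq_or_ne (δ j) 0 with h | h
  · simp [h]
  · have h1 := (Complex.continuous_ofReal.tendsto 0).comp (tendsto_inv_linear h)
    have h2 : Tendsto (fun t : ℝ => (1 + (((1 - 2 * Real.pi * δ j * t)⁻¹ : ℝ) : ℂ) *
        ((2 * Real.pi * δ j * y : ℝ) * Complex.I))⁻¹) atTop (𝓝 1) := by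
      have := ((h1.mul_const ((2 * Real.pi * δ j * y : ℝ) * Complex.I)).const_add 1).inv₀
        (by simp)
      simpa using this
    refine h2.congr' ?_
    filter_upwards [eventually_linear_ne_zero (δ j)] with t ht
    have : ((1 - 2 * Real.pi * δ j * t : ℝ) : ℂ) ≠ 0 := by exact_mod_cast ht
    generalize (1 - 2 * Real.pi * δ j * t : ℝ) = a at *
    rw [Complex.ofReal_inv]
    rw [show (1 : ℂ) + (a : ℂ)⁻¹ * ((2 * Real.pi * δ j * y : ℝ) * Complex.I) =
      (a + (2 * Real.pi * δ j * y : ℝ) * Complex.I) / a by field_simp, inv_div]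

/-- The periodized Gaussian with the damping factor inserted. -/
def dampedEntry {M : ℕ} (γ : ℝ) (δ : Fin M → ℝ) (p : ℕ) (κ : ℂ) (t c : ℝ) : ℂ :=
  ∑' j : ℤ, Complex.exp (-γ * (c + p * j) ^ 2) * κ ^ j * damping δ t (c + p * j)

theorem tendsto_dampedEntry {M : ℕ} {γ : ℝ} (hγ : 0 < γ) (δ : Fin M → ℝ) {p : ℕ} (hp : p ≠ 0)
    {κ : ℂ} (hκ : ‖κ‖ = 1) (c : ℝ) :
    Tendsto (fun t => dampedEntry γ δ p κ t c) atTop (𝓝 (gaussEntry γ p κ c)) := by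
  have hb : Summable fun j : ℤ =>
      Real.exp (γ * ‖(c : ℂ)‖ ^ 2) * Real.exp (-(γ / 2) * ((p : ℝ) * j) ^ 2) :=
    (summable_gauss hγ hp).mul_left _
  unfold dampedEntry gaussEntry
  refine tendsto_tsum_of_dominated_convergence hb (fun j => ?_) (Eventually.of_forall fun t j => ?_)
  · have h := (tendsto_damping δ (c + p * j)).const_mul
      (Complex.exp (-γ * (c + p * j) ^ 2) * κ ^ j)
    rwa [mul_one] at h
  · rw [norm_mul, norm_mul, norm_zpow, hκ, one_zpow, mul_one]
    refine (mul_le_of_le_one_right (norm_nonneg _) (norm_damping_le _ _ _)).trans ?_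
    have h := norm_exp_neg_sq_le hγ c (p * j)
    rwa [Complex.ofReal_mul, Complex.ofReal_natCast, Complex.ofReal_intCast] at h

theorem im_pole (d m : ℝ) (q : ℕ) :
    (Complex.I / (2 * Real.pi * d) - m / q : ℂ).im = (2 * Real.pi * d)⁻¹ := by
  have h : (Complex.I / (2 * Real.pi * d) - m / q : ℂ) =
      ((-(m / q) : ℝ) : ℂ) + ((2 * Real.pi * d)⁻¹ : ℝ) * Complex.I := by
    push_cast; ring
  rw [h, Complex.add_im, Complex.im_ofReal_mul, Complex.I_im, mul_one, Complex.ofReal_im, zero_add]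

/-- Squaring it + c + pj produces the oscillation e^{-2iγt(c+pj)}. Since γtp ∈ πℤ, it does not
depend on j, so the multiplier is left unchanged. -/
theorem windowEntry_imaginary {M : ℕ} {γ : ℝ} (δ : Fin M → ℝ) {p : ℕ} {t : ℝ} {n : ℤ}
    (ht : γ * t * p = n * Real.pi) (hδ : ∀ j, 1 - 2 * Real.pi * δ j * t ≠ 0) (c : ℝ)
    (x : UnitAddCircle) :
    windowEntry γ δ p (t * Complex.I + c) x =
      (Complex.exp (γ * t ^ 2) * ∏ j, ((1 - 2 * Real.pi * δ j * t : ℝ) : ℂ)⁻¹) *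
        Complex.exp (-(2 * γ * t * c) * Complex.I) * dampedEntry γ δ p (fourier 1 x) t c := by
  rw [windowEntry, dampedEntry, ← tsum_mul_left]
  refine tsum_congr fun j => ?_
  have h1 : fourier j x = (fourier 1 x) ^ j := by
    rw [fourier_apply, fourier_apply, one_zsmul, AddCircle.toCircle_zsmul, Circle.coe_zpow]
  have h2 : Complex.exp (-γ * (t * Complex.I + c + ((p * j : ℝ) : ℂ)) ^ 2) =
      Complex.exp (γ * t ^ 2) * Complex.exp (-(2 * γ * t * c) * Complex.I) *
        Complex.exp (-γ * (c + p * j) ^ 2) := by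
    have h3 : Complex.exp ((-n * j : ℤ) * (2 * Real.pi * Complex.I)) = 1 :=
      Complex.exp_int_mul_two_pi_mul_I _
    rw [← mul_one (_ * _ * _), ← h3]
    simp only [← Complex.exp_add]
    congr 1
    have ht' : (γ * t * p : ℂ) = n * Real.pi := by exact_mod_cast ht
    push_cast
    linear_combination (-2 * j * Complex.I) * ht' - γ * t ^ 2 * Complex.I_sq
  have h4 : ∏ i, (1 + 2 * Real.pi * Complex.I * δ i * (t * Complex.I + c + ((p * j : ℝ) : ℂ)))⁻¹ =
      (∏ j, ((1 - 2 * Real.pi * δ j * t : ℝ) : ℂ)⁻¹) * damping δ t (c + p * j) := by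
    rw [damping, ← prod_mul_distrib]
    refine prod_congr rfl fun i _ => ?_
    have h5 : ((1 - 2 * Real.pi * δ i * t : ℝ) : ℂ) ≠ 0 := by exact_mod_cast hδ i
    rw [div_eq_mul_inv, inv_mul_cancel_left₀ h5]
    congr 1
    push_cast
    linear_combination (2 * Real.pi * δ i * t) * Complex.I_sq
  rw [window, h1, h2, h4]
  ring

/-- The matrix of periodizations of the window. -/
def windowMatrix {M : ℕ} (γ : ℝ) (δ : Fin M → ℝ) (p q : ℕ) (ξ : ℂ) (x : UnitAddCircle) :
    Matrix (Fin p) (Fin p) ℂ :=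
  Matrix.of fun r s =>
    windowEntry γ δ p (ξ + ((((q * (s : ℕ) - p * (r : ℕ) : ℤ) : ℝ) / q : ℝ) : ℂ)) x

theorem exists_det_windowMatrix_ne_zero {M : ℕ} {γ : ℝ} (hγ : 0 < γ) (δ : Fin M → ℝ) {p q : ℕ}
    (hp : p ≠ 0) (hpq : p ≤ q) {x : UnitAddCircle} (hx : (fourier 1 x : ℂ).im ≠ 0) :
    ∃ ξ ∈ (polarSet δ q)ᶜ, (windowMatrix γ δ p q ξ x).det ≠ 0 := by
  set κ : ℂ := fourier 1 x with hκ
  have hq : q ≠ 0 := by omega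
  have hq' : (q : ℝ) ≠ 0 := by exact_mod_cast hq
  have hp' : (0 : ℝ) < p := by positivity
  let c : Fin p → Fin p → ℝ := fun r s => ((q * (s : ℕ) - p * (r : ℕ) : ℤ) : ℝ) / q
  have hc : ∀ r s : Fin p, c r s = (s : ℕ) - p * (r : ℕ) / q := fun r s => by
    simp only [c]; push_cast; field_simp
  have hG : (Matrix.of fun r s : Fin p => gaussEntry γ p κ (c r s)).det ≠ 0 := by
    simp only [hc]
    -- The points pr/q are distinct modulo p: a coincidence means r - s = mq, while |r - s| < p ≤ q.
    -- This is where αβ ≤ 1 enters.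
    refine det_gaussEntry_ne_zero hγ (fun r : Fin p => (p * (r : ℕ) / q : ℝ)) (fun r s m h => ?_) hx
    have h1 : ((r : ℕ) : ℝ) - (s : ℕ) = m * q := by
      field_simp at h
      linarith
    have h2 : ((r : ℕ) : ℤ) - (s : ℕ) = m * q := by exact_mod_cast h1
    have hm : m = 0 := by
      by_contra hm
      have h3 : (q : ℤ) ≤ |m * q| := by
        rw [abs_mul, Nat.abs_cast]
        exact le_mul_of_one_le_left (by positivity) (Int.one_le_abs hm)
      rw [← h2] at h3
      have := r.2
      have := s.2
      rcases abs_cases (((r : ℕ) : ℤ) - (s : ℕ)) with h | h <;> omega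
    ext
    rw [hm] at h2
    omega
  -- These heights are the solutions t of γtp = nπ.
  have hT : Tendsto (fun n : ℕ => (n : ℝ) * (Real.pi / (γ * p))) atTop atTop :=
    tendsto_natCast_atTop_atTop.atTop_mul_const (by have := Real.pi_pos; positivity)
  have hlim : Tendsto (fun n : ℕ => (Matrix.of fun r s : Fin p =>
      dampedEntry γ δ p κ (n * (Real.pi / (γ * p))) (c r s)).det) atTop
      (𝓝 (Matrix.of fun r s : Fin p => gaussEntry γ p κ (c r s)).det) := by
    simp only [Matrix.det_apply]
    refine tendsto_finsetSum _ fun σ _ => Tendsto.const_smul (tendsto_finsetProd _ fun i _ => ?_) _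
    exact (tendsto_dampedEntry hγ δ hp (norm_fourier_apply 1 x) _).comp hT
  have hev : ∀ᶠ n : ℕ in atTop, ∀ j, 1 - 2 * Real.pi * δ j * (n * (Real.pi / (γ * p))) ≠ 0 :=
    eventually_all.mpr fun j => hT.eventually (eventually_linear_ne_zero (δ j))
  obtain ⟨n, hn, hδ⟩ := ((hlim.eventually_ne hG).and hev).exists
  set t : ℝ := n * (Real.pi / (γ * p)) with ht
  have ht' : γ * t * p = (n : ℤ) * Real.pi := by
    rw [ht]; push_cast; field_simp
  refine ⟨t * Complex.I, ?_, ?_⟩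
  · intro hmem
    obtain ⟨j, hmem⟩ := Set.mem_iUnion.mp hmem
    obtain ⟨hj, m, hm⟩ := Set.mem_iUnion.mp hmem
    have h1 := congrArg Complex.im hm
    have h2 := im_pole (δ j) m q
    rw [Complex.ofReal_intCast] at h2
    simp only [h2, Complex.mul_im, Complex.ofReal_re, Complex.I_im, Complex.ofReal_im,
      Complex.I_re, mul_one, mul_zero, add_zero] at h1
    refine hδ j ?_
    rw [← h1, mul_inv_cancel₀, sub_self]
    have := Real.pi_ne_zero
    positivity
  · let E : ℂ := Complex.exp (γ * t ^ 2) * ∏ j, ((1 - 2 * Real.pi * δ j * t : ℝ) : ℂ)⁻¹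
    have hE : E ≠ 0 := mul_ne_zero (Complex.exp_ne_zero _)
      (prod_ne_zero_iff.mpr fun j _ => inv_ne_zero (by exact_mod_cast hδ j))
    -- As c r s = s - pr/q, the phase e^{-2iγt·c} splits into a row factor and a column factor.
    let u : Fin p → ℂ := fun r => E * Complex.exp ((2 * γ * t * (p * (r : ℕ) / q)) * Complex.I)
    let w : Fin p → ℂ := fun s => Complex.exp (-(2 * γ * t * (s : ℕ)) * Complex.I)
    have hM : windowMatrix γ δ p q (t * Complex.I) x = Matrix.of fun r s => u r *
        (Matrix.of fun r s => w s * (Matrix.of fun r s : Fin p =>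
          dampedEntry γ δ p κ t (c r s)) r s) r s := by
      ext r s
      simp only [windowMatrix, Matrix.of_apply]
      rw [windowEntry_imaginary δ ht' hδ]
      have : Complex.exp (-(2 * γ * t * ((c r s : ℝ) : ℂ)) * Complex.I) =
          Complex.exp ((2 * γ * t * (p * (r : ℕ) / q)) * Complex.I) * w s := by
        rw [hc, ← Complex.exp_add]
        congr 1
        push_cast
        ring
      rw [this]
      simp only [u, E]
      ring
    rw [hM, Matrix.det_mul_column, Matrix.det_mul_row]
    refine mul_ne_zero (prod_ne_zero_iff.mpr fun r _ => mul_ne_zero hE (Complex.exp_ne_zero _))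
      (mul_ne_zero (prod_ne_zero_iff.mpr fun r _ => Complex.exp_ne_zero _) hn)

/-- By the identity theorem the zeros are isolated. The real line avoids the poles, whose imaginary
parts 1/(2πδⱼ) are nonzero, so the real zeros form a locally null set. -/
theorem ae_det_windowMatrix_ne_zero {M : ℕ} {γ : ℝ} (hγ : 0 < γ) (δ : Fin M → ℝ) {p q : ℕ}
    (hp : p ≠ 0) (hpq : p ≤ q) {x : UnitAddCircle} (hx : (fourier 1 x : ℂ).im ≠ 0) :
    ∀ᵐ ξ : ℝ, (windowMatrix γ δ p q ξ x).det ≠ 0 := by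
  have hq : q ≠ 0 := by omega
  have hpre : IsPreconnected (polarSet δ q)ᶜ :=
    ((countable_polarSet δ q).isConnected_compl_of_one_lt_rank (by simp)).isPreconnected
  have han : AnalyticOnNhd ℂ (fun ξ => (windowMatrix γ δ p q ξ x).det) (polarSet δ q)ᶜ := by
    refine DifferentiableOn.analyticOnNhd ?_ (isClosed_polarSet δ hq).isOpen_compl
    simp only [Matrix.det_apply]
    refine DifferentiableOn.fun_sum fun σ _ => DifferentiableOn.fun_const_smul
      (DifferentiableOn.fun_finsetProd fun i _ => ?_) _
    exact differentiableOn_windowEntry hγ δ hp hq x _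
  obtain ⟨ξ₁, hξ₁, hne⟩ := exists_det_windowMatrix_ne_zero hγ δ hp hpq hx
  have hreal : ∀ ξ : ℝ, (ξ : ℂ) ∈ (polarSet δ q)ᶜ := by
    intro ξ hmem
    obtain ⟨j, hmem⟩ := Set.mem_iUnion.mp hmem
    obtain ⟨hj, m, hm⟩ := Set.mem_iUnion.mp hmem
    have h1 := congrArg Complex.im hm
    have h2 := im_pole (δ j) m q
    rw [Complex.ofReal_intCast] at h2
    simp only [h2, Complex.ofReal_im] at h1
    have := Real.pi_ne_zero
    exact inv_ne_zero (a := 2 * Real.pi * δ j) (by positivity) h1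
  refine measure_null_of_locally_null _ fun ξ₀ _ => ?_
  refine ⟨{ξ₀}, ?_, by simp⟩
  have hev : ∀ᶠ z in 𝓝[≠] (ξ₀ : ℂ), (windowMatrix γ δ p q z x).det ≠ 0 := by
    by_contra hcon
    refine hne (han.eqOn_zero_of_preconnected_of_frequently_eq_zero hpre (hreal ξ₀) ?_ hξ₁)
    rw [Filter.not_eventually] at hcon
    exact hcon.mono fun z hz => not_not.mp hz
  have hev' := (Complex.continuous_ofReal.tendsto ξ₀).eventually (eventually_nhdsWithin_iff.mp hev)
  rw [mem_nhdsWithin_iff_eventually]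
  filter_upwards [hev'] with ξ hξ hξ0
  by_contra hne'
  exact hξ0 (hξ (by simpa using hne'))

instance nullSingletonClass_haarAddCircle :
    NullSingletonClass (AddCircle.haarAddCircle : Measure UnitAddCircle) where
  measure_singleton x := by
    have h := AddCircle.volume_closedBall (1 : ℝ) (x := x) 0
    rw [Metric.closedBall_zero, AddCircle.volume_eq_smul_haarAddCircle] at h
    simpa using h

/-- A real value on the unit circle is ±1, which leaves only the finite 2-torsion. -/
theorem ae_fourier_one_im_ne_zero :
    ∀ᵐ x : UnitAddCircle ∂AddCircle.haarAddCircle, (fourier 1 x : ℂ).im ≠ 0 := by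
  have hfin : {x : UnitAddCircle | ¬ (fourier 1 x : ℂ).im ≠ 0} ⊆ {u | 2 • u = 0} := by
    intro x hx
    simp only [Set.mem_ofPred_eq, not_not, fourier_apply, one_zsmul] at hx ⊢
    refine AddCircle.injective_toCircle one_ne_zero ?_
    ext
    rw [AddCircle.toCircle_nsmul, AddCircle.toCircle_zero, Circle.coe_pow, Circle.coe_one]
    have h1 := Circle.normSq_coe (AddCircle.toCircle x)
    rw [Complex.normSq_apply, hx, mul_zero, add_zero] at h1
    apply Complex.ext
    · rw [sq, Complex.mul_re, hx]; simpa using h1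
    · rw [sq, Complex.mul_im, hx]; simp
  refine measure_mono_null hfin ?_
  refine (AddCircle.finite_torsion (1 : ℝ) (by norm_num)).measure_zero _

/-- Invertibility is known for fixed x and almost every ξ, but is used for fixed ξ. The exchange is
Fubini. -/
theorem ae_ae_det_windowMatrix_ne_zero {M : ℕ} {γ : ℝ} (hγ : 0 < γ) (δ : Fin M → ℝ) {p q : ℕ}
    (hp : p ≠ 0) (hpq : p ≤ q) :
    ∀ᵐ ξ : ℝ, ∀ᵐ x : UnitAddCircle ∂AddCircle.haarAddCircle,
      (windowMatrix γ δ p q ξ x).det ≠ 0 := by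
  rw [Measure.ae_ae_comm]
  · filter_upwards [ae_fourier_one_im_ne_zero] with x hx
    exact ae_det_windowMatrix_ne_zero hγ δ hp hpq hx
  · refine IsOpen.measurableSet (isOpen_ne_fun ?_ continuous_const)
    refine Continuous.matrix_det (continuous_matrix fun r s => ?_)
    simp only [windowMatrix, Matrix.of_apply, ← Complex.ofReal_add]
    exact (continuous_windowEntry hγ δ hp).comp
      (f := fun z : ℝ × UnitAddCircle => (z.1 + _, z.2)) (by fun_prop)

/-! ### Convolution systems on `ℓ²(ℤ)` -/

open AddCircle in
theorem ae_eq_zero_of_fourierCoeff_eq_zero {w : UnitAddCircle → ℂ} (hw : MemLp w 2 haarAddCircle)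
    (h : ∀ n, fourierCoeff w n = 0) : w =ᵐ[haarAddCircle] 0 := by
  have h0 : hw.toLp w = 0 := by
    refine fourierBasis.repr.injective ?_
    rw [map_zero]
    ext n
    rw [fourierBasis_repr, fourierCoeff_congr_ae hw.coeFn_toLp, h]
    rfl
  exact hw.coeFn_toLp.symm.trans (by rw [h0]; exact Lp.coeFn_zero _ _ _)

open AddCircle in
theorem exists_memLp_fourierCoeff {F : ℤ → ℂ} (hF : Summable fun j => ‖F j‖ ^ 2) :
    ∃ φ : UnitAddCircle → ℂ, MemLp φ 2 haarAddCircle ∧ ∀ n, fourierCoeff φ n = F n := by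
  have hmem : Memℓp F 2 := memℓp_gen (by simpa using hF)
  refine ⟨fourierBasis.repr.symm ⟨F, hmem⟩, Lp.memLp _, fun n => ?_⟩
  rw [← fourierBasis_repr, LinearIsometryEquiv.apply_symm_apply]

theorem continuous_fourierSeries {H : ℤ → ℂ} (hH : Summable fun j => ‖H j‖) :
    Continuous fun x : UnitAddCircle => ∑' j, H j * fourier j x := by
  refine continuous_tsum (fun j => by fun_prop) hH fun j x => ?_
  rw [norm_mul, norm_fourier_apply, mul_one]

theorem norm_fourierSeries_le {H : ℤ → ℂ} (hH : Summable fun j => ‖H j‖) (x : UnitAddCircle) :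
    ‖∑' j, H j * fourier j x‖ ≤ ∑' j, ‖H j‖ := by
  have h : ∀ j, ‖H j * fourier j x‖ = ‖H j‖ := fun j => by
    rw [norm_mul, norm_fourier_apply, mul_one]
  have := norm_tsum_le_tsum_norm (f := fun j => H j * fourier j x) (by simpa only [h] using hH)
  simpa only [h] using this

open AddCircle in
theorem memLp_fourierSeries_mul {H : ℤ → ℂ} (hH : Summable fun j => ‖H j‖) {φ : UnitAddCircle → ℂ}
    (hφ : MemLp φ 2 haarAddCircle) :
    MemLp (fun x => (∑' j, H j * fourier j x) * φ x) 2 haarAddCircle := by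
  refine MemLp.of_le_mul (c := ∑' j, ‖H j‖) hφ
    ((continuous_fourierSeries hH).aestronglyMeasurable.mul hφ.1) (Eventually.of_forall fun x => ?_)
  rw [norm_mul]
  gcongr
  exact norm_fourierSeries_le hH x

open AddCircle in
-- Multiplication by the symbol is convolution of coefficients; absolute summability of H permits
-- termwise integration.
theorem fourierCoeff_fourierSeries_mul {H : ℤ → ℂ} (hH : Summable fun j => ‖H j‖)
    {φ : UnitAddCircle → ℂ} (hφ : MemLp φ 2 haarAddCircle) (n : ℤ) :
    fourierCoeff (fun x => (∑' j, H j * fourier j x) * φ x) n =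
      ∑' j, H j * fourierCoeff φ (n - j) := by
  have hint : Integrable φ haarAddCircle := hφ.integrable (by norm_num)
  have hFint : ∀ j : ℤ, Integrable (fun x => H j * (fourier (-(n - j)) x * φ x)) haarAddCircle :=
    fun j => (hint.bdd_mul (c := 1) (fourier (-(n - j))).continuous.aestronglyMeasurable
      (Eventually.of_forall fun x => (norm_fourier_apply _ _).le)).const_mul _
  have hnorm : ∀ j : ℤ, ∫ x, ‖H j * (fourier (-(n - j)) x * φ x)‖ ∂haarAddCircle =
      ‖H j‖ * ∫ x, ‖φ x‖ ∂haarAddCircle := fun j => by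
    rw [← integral_const_mul]
    congr 1
    funext x
    rw [norm_mul, norm_mul, norm_fourier_apply, one_mul]
  have h := integral_tsum_of_summable_integral_norm hFint
    (by simpa only [hnorm] using hH.mul_right _)
  simp only [fourierCoeff, smul_eq_mul]
  rw [show (∑' j, H j * ∫ t, fourier (-(n - j)) t * φ t ∂haarAddCircle) =
    ∑' j, ∫ t, H j * (fourier (-(n - j)) t * φ t) ∂haarAddCircle from
    tsum_congr fun j => (integral_const_mul _ _).symm, h]
  congr 1
  funext x
  rw [← mul_assoc, ← tsum_mul_left, ← tsum_mul_right]
  refine tsum_congr fun j => ?_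
  rw [show -(n - j) = -n + j by ring, fourier_add]
  ring

open AddCircle in
/-- A square system of convolution equations on `ℓ²(ℤ)` with `ℓ¹` coefficients, whose symbol is
almost everywhere invertible, has only the trivial solution. -/
theorem eq_zero_of_convolution_eq_zero {ι : Type*} [Fintype ι] [DecidableEq ι] {F : ι → ℤ → ℂ}
    (hF : ∀ s, Summable fun j => ‖F s j‖ ^ 2) {H : ι → ι → ℤ → ℂ}
    (hH : ∀ r s, Summable fun j => ‖H r s j‖)
    (h : ∀ r (m : ℤ), ∑ s, ∑' j, F s j * H r s (j - m) = 0)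
    (hdet : ∀ᵐ x : UnitAddCircle ∂haarAddCircle,
      (Matrix.of fun r s => ∑' j, H r s j * fourier j x).det ≠ 0) (s : ι) (j : ℤ) :
    F s j = 0 := by
  -- The equations are correlations, so the sequences are reflected to become convolutions.
  have hF' : ∀ s, Summable fun j => ‖F s (-j)‖ ^ 2 := fun s =>
    ((Equiv.neg ℤ).summable_iff).mpr (hF s)
  choose φ hφ hφF using fun s => exists_memLp_fourierCoeff (hF' s)
  have hmem : ∀ r, MemLp (fun x => ∑ s, (∑' j, H r s j * fourier j x) * φ s x) 2 haarAddCircle :=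
    fun r => memLp_finsetSum _ fun s _ => memLp_fourierSeries_mul (hH r s) (hφ s)
  have hzero : ∀ r, (fun x => ∑ s, (∑' j, H r s j * fourier j x) * φ s x) =ᵐ[haarAddCircle] 0 := by
    intro r
    refine ae_eq_zero_of_fourierCoeff_eq_zero (hmem r) fun n => ?_
    have h1 : fourierCoeff (fun x => ∑ s, (∑' j, H r s j * fourier j x) * φ s x) n =
        ∑ s, fourierCoeff (fun x => (∑' j, H r s j * fourier j x) * φ s x) n := by
      simp only [fourierCoeff, smul_eq_mul, mul_sum]
      refine integral_finsetSum _ fun s _ => ?_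
      exact ((memLp_fourierSeries_mul (hH r s) (hφ s)).integrable (by norm_num)).bdd_mul (c := 1)
        (fourier (-n)).continuous.aestronglyMeasurable
        (Eventually.of_forall fun x => (norm_fourier_apply _ _).le)
    rw [h1, ← h r (-n)]
    refine sum_congr rfl fun s _ => ?_
    rw [fourierCoeff_fourierSeries_mul (hH r s) (hφ s), ← (Equiv.addRight n).tsum_eq]
    refine tsum_congr fun j => ?_
    rw [hφF, Equiv.coe_addRight, mul_comm]
    congr 2 <;> ring
  have hφ0 : ∀ s, φ s =ᵐ[haarAddCircle] 0 := by
    intro s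
    filter_upwards [hdet, ae_all_iff.mpr hzero] with x hx hx0
    have := Matrix.eq_zero_of_mulVec_eq_zero hx (v := fun s => φ s x) (funext fun r => hx0 r)
    exact congrFun this s
  have h2 := hφF s (-j)
  rw [fourierCoeff_congr_ae (hφ0 s), neg_neg] at h2
  rw [← h2]
  simp [fourierCoeff]

/-! ### Periodization -/

theorem summable_integral_norm_comp_add {E : Type*} [NormedAddCommGroup E] [NormedSpace ℝ E]
    {u : ℝ → E} (hu : Integrable u) :
    Summable fun n : ℤ => ∫ ξ in Set.Ioc (0 : ℝ) 1, ‖u (ξ + n)‖ := by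
  have h := hu.norm.hasSum_intervalIntegral_comp_add_int.summable
  simpa only [intervalIntegral.integral_of_le zero_le_one] using h

theorem ae_summable_norm_comp_add {E : Type*} [NormedAddCommGroup E] [NormedSpace ℝ E]
    {u : ℝ → E} (hu : Integrable u) :
    (∫⁻ ξ in Set.Ioc (0 : ℝ) 1, ∑' n : ℤ, ‖u (ξ + n)‖ₑ < ⊤) ∧
    ∀ᵐ ξ ∂volume.restrict (Set.Ioc (0 : ℝ) 1), Summable fun n : ℤ => ‖u (ξ + n)‖ := by
  have hi : ∀ n : ℤ, Integrable (fun ξ => u (ξ + n)) (volume.restrict (Set.Ioc (0 : ℝ) 1)) :=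
    fun n => (hu.comp_add_right (n : ℝ)).integrableOn
  have h1 : ∫⁻ ξ in Set.Ioc (0 : ℝ) 1, ∑' n : ℤ, ‖u (ξ + n)‖ₑ ≠ ⊤ := by
    rw [lintegral_tsum fun n => (hi n).1.enorm]
    have h2 : ∀ n : ℤ, ∫⁻ ξ in Set.Ioc (0 : ℝ) 1, ‖u (ξ + n)‖ₑ =
        ENNReal.ofReal (∫ ξ in Set.Ioc (0 : ℝ) 1, ‖u (ξ + n)‖) := fun n => by
      rw [ofReal_integral_norm_eq_lintegral_enorm (hi n)]
    simp only [h2]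
    exact (summable_integral_norm_comp_add hu).tsum_ofReal_ne_top
  refine ⟨h1.lt_top, ?_⟩
  filter_upwards [ae_lt_top' (AEMeasurable.tsum fun n => (hi n).1.enorm) h1] with ξ hξ
  have h3 : ∑' n : ℤ, ((‖u (ξ + n)‖₊ : NNReal) : ENNReal) ≠ ⊤ := hξ.ne
  exact NNReal.summable_coe.mpr (ENNReal.tsum_coe_ne_top_iff_summable.mp h3)

theorem integrable_periodization {u : ℝ → ℂ} (hu : Integrable u) :
    Integrable (fun ξ => ∑' n : ℤ, u (ξ + n)) (volume.restrict (Set.Ioc (0 : ℝ) 1)) := by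
  obtain ⟨h1, h2⟩ := ae_summable_norm_comp_add hu
  have hi : ∀ n : ℤ, AEStronglyMeasurable (fun ξ => u (ξ + n))
      (volume.restrict (Set.Ioc (0 : ℝ) 1)) := fun n => (hu.comp_add_right (n : ℝ)).1.restrict
  refine ⟨?_, ?_⟩
  · have hm : ∀ N : ℕ, AEStronglyMeasurable (fun ξ => ∑ n ∈ Finset.Icc (-(N : ℤ)) N, u (ξ + n))
        (volume.restrict (Set.Ioc (0 : ℝ) 1)) := fun N =>
      Finset.aestronglyMeasurable_fun_sum _ fun n _ => hi n
    refine aestronglyMeasurable_of_tendsto_ae atTop hm ?_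
    filter_upwards [h2] with ξ hξ
    exact hξ.of_norm.hasSum.comp tendsto_Icc_neg
  · refine lt_of_le_of_lt (lintegral_mono_ae ?_) h1
    filter_upwards [h2] with ξ hξ
    exact enorm_tsum_le_tsum_enorm

/-- The functional is bounded by ‖u‖₁ and vanishes on the trigonometric polynomials, which are
dense. -/
theorem integral_mul_continuousMap_eq_zero {u : ℝ → ℂ} (hu : Integrable u)
    (h : ∀ k : ℤ, ∫ ξ, u ξ * fourier k (ξ : UnitAddCircle) = 0) (φ : C(UnitAddCircle, ℂ)) :
    ∫ ξ, u ξ * φ (ξ : UnitAddCircle) = 0 := by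
  have hcoe : Continuous fun ξ : ℝ => (ξ : UnitAddCircle) := AddCircle.continuous_mk' 1
  have hint : ∀ φ : C(UnitAddCircle, ℂ), Integrable fun ξ : ℝ => u ξ * φ (ξ : UnitAddCircle) :=
    fun φ => hu.mul_bdd (c := ‖φ‖) (φ.continuous.comp hcoe).aestronglyMeasurable
      (Eventually.of_forall fun ξ => φ.norm_coe_le_norm _)
  let L : C(UnitAddCircle, ℂ) →L[ℂ] ℂ := LinearMap.mkContinuous
    { toFun := fun φ => ∫ ξ, u ξ * φ (ξ : UnitAddCircle)
      map_add' := fun φ ψ => by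
        rw [← integral_add (hint φ) (hint ψ)]
        simp only [ContinuousMap.add_apply, mul_add]
      map_smul' := fun c φ => by
        rw [RingHom.id_apply, smul_eq_mul, ← integral_const_mul]
        congr 1
        funext ξ
        simp only [ContinuousMap.smul_apply, smul_eq_mul]
        ring } (∫ ξ, ‖u ξ‖) fun φ => by
      refine (norm_integral_le_integral_norm _).trans ?_
      rw [← integral_mul_const]
      refine integral_mono (hint φ).norm (hu.norm.mul_const _) fun ξ => ?_
      simp only [norm_mul]
      gcongr
      exact φ.norm_coe_le_norm _
  have hL : L = 0 := by
    refine ContinuousLinearMap.ext_on (s := Set.range (@fourier 1)) ?_ ?_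
    · rw [dense_iff_closure_eq, ← Submodule.topologicalClosure_coe, span_fourier_closure_eq_top]
      rfl
    · rintro _ ⟨k, rfl⟩
      exact h k
  exact congrArg (fun T : C(UnitAddCircle, ℂ) →L[ℂ] ℂ => T φ) hL

/-- If the Fourier transform of an integrable function vanishes on `ℤ`, then its periodization
vanishes almost everywhere. -/
theorem periodization_eq_zero {u : ℝ → ℂ} (hu : Integrable u)
    (h : ∀ k : ℤ, ∫ ξ, u ξ * fourier k (ξ : UnitAddCircle) = 0) :
    ∀ᵐ ξ ∂volume.restrict (Set.Ioc (0 : ℝ) 1), ∑' n : ℤ, u (ξ + n) = 0 := by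
  have hv := integrable_periodization hu
  have hmain : ∀ᵐ ξ : ℝ, ξ ∈ Set.Ioo (0 : ℝ) 1 → ∑' n : ℤ, u (ξ + n) = 0 := by
    refine IsOpen.ae_eq_zero_of_integral_contDiff_smul_eq_zero isOpen_Ioo
      (IntegrableOn.locallyIntegrableOn (hv.mono_measure
        (Measure.restrict_mono_set volume Set.Ioo_subset_Ioc_self))) fun g hg hgc hgs => ?_
    have hg0 : ∀ ξ, ξ ∉ Set.Ioo (0 : ℝ) 1 → g ξ = 0 := fun ξ hξ =>
      image_eq_zero_of_notMem_tsupport fun hmem => hξ (hgs hmem)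
    -- A test function supported in (0, 1) vanishes at both ends and so descends to the circle.
    let φ : C(UnitAddCircle, ℂ) := ⟨AddCircle.liftIco 1 0 fun ξ => (g ξ : ℂ),
      AddCircle.liftIco_zero_continuous (by simp [hg0]) (by
        have := hg.continuous
        fun_prop)⟩
    have hlift : ∀ ξ ∈ Set.Ico (0 : ℝ) 1, φ (ξ : UnitAddCircle) = g ξ := fun ξ hξ =>
      AddCircle.liftIco_coe_apply (p := (1 : ℝ)) (a := 0) (f := fun ξ => (g ξ : ℂ))
        (by rwa [zero_add])
    have hφ : ∀ ξ ∈ Set.Ioc (0 : ℝ) 1, φ (ξ : UnitAddCircle) = g ξ := by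
      intro ξ hξ
      rcases eq_or_lt_of_le hξ.2 with rfl | h1
      · have h2 : ((1 : ℝ) : UnitAddCircle) = ((0 : ℝ) : UnitAddCircle) :=
          (AddCircle.coe_period (1 : ℝ)).trans (by simp)
        rw [h2, hlift 0 (by simp), hg0 0 (by simp), hg0 1 (by simp)]
      · exact hlift ξ ⟨hξ.1.le, h1⟩
    have hz := integral_mul_continuousMap_eq_zero hu h φ
    have hper : ∀ (ξ : ℝ) (n : ℤ), ((ξ + n : ℝ) : UnitAddCircle) = ξ := fun ξ n => by
      have : ((n : ℝ) : UnitAddCircle) = 0 :=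
        (AddCircle.coe_eq_zero_iff (1 : ℝ)).mpr ⟨n, by simp⟩
      rw [AddCircle.coe_add, this, add_zero]
    have hiu : Integrable fun ξ : ℝ => u ξ * φ (ξ : UnitAddCircle) :=
      hu.mul_bdd (c := ‖φ‖) (φ.continuous.comp (AddCircle.continuous_mk' 1)).aestronglyMeasurable
        (Eventually.of_forall fun ξ => φ.norm_coe_le_norm _)
    -- Unfolding: the integral of u·φ over the line is that of the periodization against φ over one
    -- period.
    have hs := hiu.hasSum_intervalIntegral_comp_add_int.tsum_eq
    simp only [intervalIntegral.integral_of_le zero_le_one, hper] at hs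
    have hsum := summable_integral_norm_comp_add hiu
    simp only [hper] at hsum
    rw [integral_tsum_of_summable_integral_norm (fun n : ℤ => by
      simpa only [hper] using (hiu.comp_add_right (n : ℝ)).restrict) hsum, hz] at hs
    have hset : ∫ ξ, g ξ • ∑' n : ℤ, u (ξ + n) =
        ∫ ξ in Set.Ioc (0 : ℝ) 1, g ξ • ∑' n : ℤ, u (ξ + n) := by
      rw [setIntegral_eq_integral_of_forall_compl_eq_zero]
      intro ξ hξ
      rw [hg0 ξ fun h => hξ (Set.Ioo_subset_Ioc_self h), zero_smul]
    rw [hset, ← hs]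
    refine setIntegral_congr_fun measurableSet_Ioc fun ξ hξ => ?_
    rw [tsum_mul_right, hφ ξ hξ, mul_comm, Complex.real_smul]
  rw [← Measure.restrict_congr_set Ioo_ae_eq_Ioc, ae_restrict_iff' measurableSet_Ioo]
  exact hmain

/-! ### Uniqueness on the Fourier side -/

theorem memLp_window {M : ℕ} {γ : ℝ} (hγ : 0 < γ) (δ : Fin M → ℝ) (c : ℝ) :
    MemLp (fun ξ : ℝ => window γ δ ((ξ - c : ℝ) : ℂ)) 2 := by
  have h0 : MemLp (fun ξ : ℝ => window γ δ (ξ : ℂ)) 2 := by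
    rw [memLp_two_iff_integrable_sq_norm (continuous_window γ δ).aestronglyMeasurable]
    refine (integrable_exp_neg_mul_sq hγ).mono'
      ((continuous_window γ δ).norm.pow 2).aestronglyMeasurable (Eventually.of_forall fun ξ => ?_)
    have h := norm_window_ofReal_le hγ δ (x := 0) (y := ξ) (R := 0) (by simp)
    rw [Complex.ofReal_zero, zero_add] at h
    simp only [ne_eq, OfNat.ofNat_ne_zero, not_false_eq_true, zero_pow, mul_zero, Real.exp_zero,
      one_mul] at h
    rw [Real.norm_of_nonneg (by positivity)]
    calc ‖window γ δ ξ‖ ^ 2 ≤ Real.exp (-(γ / 2) * ξ ^ 2) ^ 2 := by gcongr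
      _ = Real.exp (-γ * ξ ^ 2) := by rw [← Real.exp_nat_mul]; congr 1; push_cast; ring
  exact h0.comp_measurePreserving (measurePreserving_sub_right volume c)

theorem summable_norm_window {M : ℕ} {γ : ℝ} (hγ : 0 < γ) (δ : Fin M → ℝ) (x : ℝ) {p : ℕ}
    (hp : p ≠ 0) : Summable fun j : ℤ => ‖window γ δ ((x + p * j : ℝ) : ℂ)‖ := by
  refine ((summable_gauss hγ hp).mul_left (Real.exp (γ * |x| ^ 2))).of_nonneg_of_le
    (fun _ => norm_nonneg _) fun j => ?_
  rw [Complex.ofReal_add]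
  exact norm_window_ofReal_le hγ δ le_rfl

theorem summable_mul_of_sq {a b : ℤ → ℂ} (ha : Summable fun n => ‖a n‖ ^ 2)
    (hb : Summable fun n => ‖b n‖) : Summable fun n => a n * b n := by
  obtain ⟨C, hC⟩ := ha.tendsto_cofinite_zero.bddAbove_range_of_cofinite
  refine Summable.of_norm ((hb.mul_left (C + 1)).of_nonneg_of_le (fun _ => norm_nonneg _) fun n => ?_)
  have h1 : ‖a n‖ ^ 2 ≤ C := hC ⟨n, rfl⟩
  rw [norm_mul]
  gcongr
  nlinarith [norm_nonneg (a n), sq_nonneg (‖a n‖ - 1)]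

theorem eq_zero_of_integral_comp_add_eq_zero {f : ℝ → ℂ} (hf : MemLp f 2)
    (h : ∀ᵐ ξ ∂volume.restrict (Set.Ioc (0 : ℝ) 1), ∀ n : ℤ, f (ξ + n) = 0) :
    f =ᵐ[volume] 0 := by
  have hi : Integrable fun ξ => ‖f ξ‖ ^ 2 := (memLp_two_iff_integrable_sq_norm hf.1).mp hf
  have h1 := hi.hasSum_intervalIntegral_comp_add_int
  have h2 : ∀ n : ℤ, ∫ x in (0 : ℝ)..1, ‖f (x + n)‖ ^ 2 = 0 := fun n => by
    rw [intervalIntegral.integral_of_le zero_le_one]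
    refine integral_eq_zero_of_ae ?_
    filter_upwards [h] with ξ hξ
    simp [hξ n]
  simp only [h2] at h1
  have h3 := (integral_eq_zero_iff_of_nonneg (fun ξ => by positivity) hi).mp
    (h1.unique hasSum_zero)
  filter_upwards [h3] with ξ hξ
  simpa using hξ

theorem windowEntry_eq_tsum {M : ℕ} (γ : ℝ) (δ : Fin M → ℝ) (p : ℕ) (y : ℝ) (x : UnitAddCircle) :
    windowEntry γ δ p y x = ∑' j : ℤ, window γ δ ((y + p * j : ℝ) : ℂ) * fourier j x := by
  simp only [windowEntry, Complex.ofReal_add]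

/-- The samples along `ξ + ℤ` of a function orthogonal to all time-frequency shifts vanish. -/
theorem eq_zero_of_tsum_window_eq_zero {M : ℕ} {γ : ℝ} (hγ : 0 < γ) (δ : Fin M → ℝ) {p q : ℕ}
    (hp : p ≠ 0) (hpq : p ≤ q) {ξ : ℝ} {a : ℤ → ℂ} (ha : Summable fun n => ‖a n‖ ^ 2)
    (hdet : ∀ᵐ x : UnitAddCircle ∂AddCircle.haarAddCircle, (windowMatrix γ δ p q ξ x).det ≠ 0)
    (h : ∀ l : ℤ, ∑' n : ℤ, a n * window γ δ ((ξ + n - p / q * l : ℝ) : ℂ) = 0) (n : ℤ) :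
    a n = 0 := by
  have : NeZero p := ⟨hp⟩
  have hq : (q : ℝ) ≠ 0 := by
    have : q ≠ 0 := by omega
    exact_mod_cast this
  have hinj : ∀ s : Fin p, Function.Injective fun j : ℤ => ((s : ℕ) : ℤ) + p * j := fun s i j hij => by
    simpa [hp] using hij
  let c : Fin p → Fin p → ℝ := fun r s => ξ + ((q * (s : ℕ) - p * (r : ℕ) : ℤ) : ℝ) / q
  have key := eq_zero_of_convolution_eq_zero (ι := Fin p)
    (F := fun s j => a ((s : ℕ) + p * j)) (H := fun r s j => window γ δ ((c r s + p * j : ℝ) : ℂ))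
    (fun s => ha.comp_injective (hinj s)) (fun r s => summable_norm_window hγ δ _ hp)
    (fun r m => ?_) ?_
  · have h1 := key (Fin.ofNat p (n.natMod p)) (n / p)
    have h2 := (Int.divModEquiv p).symm_apply_apply n
    simp only [Int.divModEquiv, Equiv.coe_fn_mk, Equiv.coe_fn_symm_mk] at h2
    rw [← h2]
    rw [add_comm, mul_comm]
    exact h1
  -- Only the p residue classes l = qm + r with r < p, out of q, are used; this makes the system
  -- square.
  · have hsum : Summable fun n : ℤ =>
        a n * window γ δ ((ξ + n - p / q * ((q * m + (r : ℕ) : ℤ) : ℝ) : ℝ) : ℂ) := by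
      refine summable_mul_of_sq ha ?_
      refine (summable_norm_window hγ δ (ξ - p / q * ((q * m + (r : ℕ) : ℤ) : ℝ))
        one_ne_zero).congr fun n => ?_
      congr 3
      push_cast
      ring
    rw [← h (q * m + (r : ℕ)), tsum_int_eq_sum_tsum (p := p) hsum]
    refine sum_congr rfl fun s _ => tsum_congr fun j => ?_
    congr 3
    simp only [c]
    push_cast
    field_simp
    ring
  · filter_upwards [hdet] with x hx
    convert hx using 3
    ext r s
    simp only [windowMatrix, Matrix.of_apply, ← Complex.ofReal_add, windowEntry_eq_tsum, c]

/-- Uniqueness for the Gabor system of the window with unit frequency period. -/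
theorem ae_eq_zero_of_orthogonal {M : ℕ} {γ : ℝ} (hγ : 0 < γ) (δ : Fin M → ℝ) {p q : ℕ}
    (hp : p ≠ 0) (hpq : p ≤ q) {f : ℝ → ℂ} (hf : MemLp f 2)
    (h : ∀ k l : ℤ, ∫ ξ : ℝ, f ξ * window γ δ ((ξ - p / q * l : ℝ) : ℂ) *
      fourier k (ξ : UnitAddCircle) = 0) : f =ᵐ[volume] 0 := by
  refine eq_zero_of_integral_comp_add_eq_zero hf ?_
  have hi : Integrable fun ξ => ‖f ξ‖ ^ 2 := (memLp_two_iff_integrable_sq_norm hf.1).mp hf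
  have h1 : ∀ᵐ ξ ∂volume.restrict (Set.Ioc (0 : ℝ) 1), ∀ l : ℤ,
      ∑' n : ℤ, f (ξ + n) * window γ δ ((ξ + n - p / q * l : ℝ) : ℂ) = 0 :=
    ae_all_iff.mpr fun l => periodization_eq_zero (hf.integrable_mul (memLp_window hγ δ (p / q * l)))
      fun k => h k l
  filter_upwards [h1, (ae_summable_norm_comp_add hi).2,
    ae_restrict_of_ae (ae_ae_det_windowMatrix_ne_zero hγ δ hp hpq)] with ξ hξ hs hdet
  exact eq_zero_of_tsum_window_eq_zero hγ δ hp hpq (a := fun n => f (ξ + n))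
    (by simpa using hs) hdet hξ

/-! ### The Fourier transform of time-frequency shifts -/

/-- The character `x ↦ e^{2πibx}`. -/
def character (b x : ℝ) : ℂ := Complex.exp (2 * Real.pi * Complex.I * b * x)

theorem norm_character (b x : ℝ) : ‖character b x‖ = 1 := by
  rw [character, show (2 * Real.pi * Complex.I * b * x : ℂ) =
    ((2 * Real.pi * b * x : ℝ) : ℂ) * Complex.I by push_cast; ring, Complex.norm_exp_ofReal_mul_I]

theorem iteratedDeriv_character (b : ℝ) (n : ℕ) :
    iteratedDeriv n (character b) = fun x => (2 * Real.pi * Complex.I * b) ^ n * character b x := by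
  induction n with
  | zero => simp
  | succ n ih =>
    rw [iteratedDeriv_succ, ih]
    funext x
    have h1 : HasDerivAt (fun x : ℝ => (2 * Real.pi * Complex.I * b * x : ℂ))
        (2 * Real.pi * Complex.I * b) x := by
      simpa using ((hasDerivAt_id x).ofReal_comp.const_mul (2 * Real.pi * Complex.I * b : ℂ))
    refine ((h1.cexp).const_mul ((2 * Real.pi * Complex.I * b : ℂ) ^ n)).deriv.trans ?_
    simp only [character]
    ring

theorem hasTemperateGrowth_character (b : ℝ) : (character b).HasTemperateGrowth := by
  refine ⟨?_, fun n => ⟨0, ‖(2 * Real.pi * Complex.I * b : ℂ) ^ n‖, fun x => ?_⟩⟩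
  · unfold character
    refine ContDiff.cexp ?_
    exact contDiff_const.mul Complex.ofRealCLM.contDiff
  · rw [norm_iteratedFDeriv_eq_norm_iteratedDeriv, iteratedDeriv_character, norm_mul,
      norm_character, pow_zero]

theorem coeFn_timeFrequencyShift (b a : ℝ) (g : Lp ℂ 2 (volume : Measure ℝ)) :
    timeFrequencyShift b a g =ᵐ[volume] fun x => character b x * g (x - a) :=
  MemLp.coeFn_toLp _

theorem ae_comp_sub {P : ℝ → Prop} (h : ∀ᵐ x, P x) (a : ℝ) : ∀ᵐ x : ℝ, P (x - a) :=
  (measurePreserving_sub_right volume a).quasiMeasurePreserving.ae h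

theorem isometry_timeFrequencyShift (b a : ℝ) : Isometry (timeFrequencyShift b a) := by
  refine Isometry.of_dist_eq fun f g => ?_
  rw [dist_eq_norm, dist_eq_norm, Lp.norm_def, Lp.norm_def]
  congr 1
  have h1 : ⇑(timeFrequencyShift b a f - timeFrequencyShift b a g) =ᵐ[volume]
      fun x => character b x * (f - g) (x - a) := by
    filter_upwards [Lp.coeFn_sub (timeFrequencyShift b a f) (timeFrequencyShift b a g),
      coeFn_timeFrequencyShift b a f, coeFn_timeFrequencyShift b a g,
      ae_comp_sub (Lp.coeFn_sub f g) a] with x h1 h2 h3 h4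
    rw [h1, h4, Pi.sub_apply, Pi.sub_apply, h2, h3, mul_sub]
  have h2 : eLpNorm (fun x => character b x * (f - g) (x - a)) 2 volume =
      eLpNorm (fun x => (f - g) (x - a)) 2 volume :=
    eLpNorm_congr_norm_ae (Eventually.of_forall fun x => by rw [norm_mul, norm_character, one_mul])
  rw [eLpNorm_congr_ae h1, h2]
  exact eLpNorm_comp_measurePreserving (Lp.aestronglyMeasurable _)
    (measurePreserving_sub_right volume a)

open FourierTransform SchwartzMap in
-- Both sides are continuous in g, so Schwartz functions suffice, and there it is a change of
-- variable.
theorem fourier_timeFrequencyShift (b a : ℝ) (g : Lp ℂ 2 (volume : Measure ℝ)) :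
    𝓕 (timeFrequencyShift b a g) = character a b • timeFrequencyShift (-a) b (𝓕 g) := by
  refine DenseRange.induction_on (p := fun g : Lp ℂ 2 (volume : Measure ℝ) =>
    𝓕 (timeFrequencyShift b a g) = character a b • timeFrequencyShift (-a) b (𝓕 g))
    (SchwartzMap.denseRange_toLpCLM (E := ℝ) (F := ℂ) (p := 2) (μ := volume) ENNReal.ofNat_ne_top) g
    ?_ ?_
  · refine isClosed_eq ?_ ?_
    · exact (Lp.fourierTransformₗᵢ ℝ ℂ).continuous.comp (isometry_timeFrequencyShift b a).continuous
    · exact (continuous_const_smul (T := Lp ℂ 2 (volume : Measure ℝ)) (character a b)).comp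
        ((isometry_timeFrequencyShift (-a) b).continuous.comp
          (Lp.fourierTransformₗᵢ ℝ ℂ).continuous)
  · intro φ
    rw [SchwartzMap.toLpCLM_apply]
    let ψ : 𝓢(ℝ, ℂ) := smulLeftCLM ℂ (character b) (compSubConstCLM ℂ a φ)
    have hψ : ∀ x, ψ x = character b x * φ (x - a) := fun x => by
      simp only [ψ, smulLeftCLM_apply_apply (hasTemperateGrowth_character b),
        compSubConstCLM_apply, smul_eq_mul]
    have h1 : timeFrequencyShift b a (φ.toLp 2) = ψ.toLp 2 := by
      refine Lp.ext ?_
      filter_upwards [coeFn_timeFrequencyShift b a (φ.toLp 2), ψ.coeFn_toLp 2,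
        ae_comp_sub (φ.coeFn_toLp 2 volume) a] with x h1 h2 h3
      rw [h1, h2, h3, hψ]
    have h4 : ∀ ξ, 𝓕 ψ ξ = character a b * (character (-a) ξ * 𝓕 φ (ξ - b)) := by
      intro ξ
      rw [SchwartzMap.fourier_coe, SchwartzMap.fourier_coe, Real.fourier_real_eq_integral_exp_smul,
        Real.fourier_real_eq_integral_exp_smul, ← integral_const_mul, ← integral_const_mul,
        ← integral_add_right_eq_self _ a]
      congr 1
      funext x
      rw [hψ, add_sub_cancel_right, smul_eq_mul, smul_eq_mul, ← mul_assoc, ← mul_assoc, ← mul_assoc]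
      congr 1
      simp only [character, ← Complex.exp_add]
      congr 1
      push_cast
      ring
    rw [h1, SchwartzMap.toLp_fourier_eq, SchwartzMap.toLp_fourier_eq]
    refine Lp.ext ?_
    filter_upwards [(𝓕 ψ).coeFn_toLp 2, Lp.coeFn_smul (character a b)
      (timeFrequencyShift (-a) b ((𝓕 φ).toLp 2)), coeFn_timeFrequencyShift (-a) b ((𝓕 φ).toLp 2),
      ae_comp_sub ((𝓕 φ).coeFn_toLp 2 volume) b] with ξ h5 h6 h7 h8
    rw [h5, h6, Pi.smul_apply, h7, h8, smul_eq_mul, h4]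

/-- The family of windows is stable under dilation, which permits the reduction to α = 1. -/
theorem window_div {M : ℕ} (γ : ℝ) (δ : Fin M → ℝ) (α : ℝ) (ξ : ℂ) :
    window γ δ (ξ / α) = window (γ / α ^ 2) (fun j => δ j / α) ξ := by
  unfold window
  congr 1
  · congr 1
    push_cast
    ring
  · refine prod_congr rfl fun j _ => ?_
    push_cast
    ring

/-- A function on the Fourier side that is orthogonal to the Gabor system of the window vanishes. -/
theorem ae_eq_zero_of_integral_window_eq_zero {M : ℕ} {γ : ℝ} (hγ : 0 < γ) (δ : Fin M → ℝ)
    {α β : ℝ} (hα : 0 < α) {p q : ℕ} (hp : p ≠ 0) (hpq : p ≤ q) (hαβ : α * β = p / q)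
    {f : ℝ → ℂ} (hfm : StronglyMeasurable f) (hf : MemLp f 2)
    (h : ∀ k l : ℤ, ∫ ξ : ℝ, f ξ *
      (character (α * k) ξ * window γ δ ((ξ - β * l : ℝ) : ℂ)) = 0) : f =ᵐ[volume] 0 := by
  have hi : Integrable fun ξ => ‖f ξ‖ ^ 2 := (memLp_two_iff_integrable_sq_norm hf.1).mp hf
  have hFm : StronglyMeasurable fun η : ℝ => f (η / α) :=
    hfm.comp_measurable (measurable_id.div_const α)
  have hF : MemLp (fun η : ℝ => f (η / α)) 2 :=
    (memLp_two_iff_integrable_sq_norm hFm.aestronglyMeasurable).mpr (hi.comp_div hα.ne')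
  have h0 := ae_eq_zero_of_orthogonal (γ := γ / α ^ 2) (by positivity) (fun j => δ j / α) hp hpq hF
    fun k l => by
      have h1 := Measure.integral_comp_div (fun ξ : ℝ => f ξ *
        (character (α * k) ξ * window γ δ ((ξ - β * l : ℝ) : ℂ))) α
      rw [h k l, smul_zero] at h1
      rw [← h1]
      congr 1
      funext η
      have h2 : window γ δ ((η / α - β * l : ℝ) : ℂ) =
          window (γ / α ^ 2) (fun j => δ j / α) ((η - p / q * l : ℝ) : ℂ) := by
        rw [← window_div, ← hαβ, ← Complex.ofReal_div]
        congr 2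
        field_simp
      have h3 : character (α * k) (η / α) = fourier k (η : UnitAddCircle) := by
        rw [fourier_coe_apply, character]
        congr 1
        have : (α : ℂ) ≠ 0 := by exact_mod_cast hα.ne'
        push_cast
        field_simp
      rw [h2, h3]
      ring
  have h4 := Measure.integral_comp_div (fun ξ : ℝ => ‖f ξ‖ ^ 2) α
  rw [integral_eq_zero_of_ae (by
    filter_upwards [h0] with η hη
    have : f (η / α) = 0 := hη
    simp [this])] at h4
  have h5 : ∫ ξ : ℝ, ‖f ξ‖ ^ 2 = 0 := by
    rcases smul_eq_zero.mp h4.symm with h6 | h6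
    · exact absurd (abs_eq_zero.mp h6) hα.ne'
    · exact h6
  have h7 := (integral_eq_zero_iff_of_nonneg (fun ξ => by positivity) hi).mp h5
  filter_upwards [h7] with ξ hξ
  simpa using hξ

end GaborSystem
end

/-- Here `FourierTransform.fourier g` is the Fourier (Plancherel) transform on `L²(ℝ)`, with the
normalization `∫ g(x) e^{-2π i x ξ} dx`. A window `g` as below is totally positive by Schoenberg's
theorem; this is not needed as a separate hypothesis. -/
theorem corollary3p5 (M : ℕ) (δ : Fin M → ℝ) (γ : ℝ) (hγ : 0 < γ)
    (g : Lp ℂ 2 (volume : Measure ℝ))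
    (hg : (FourierTransform.fourier g : Lp ℂ 2 (volume : Measure ℝ)) =ᵐ[volume]
      fun ξ : ℝ => Complex.exp (-(γ : ℂ) * (ξ : ℂ) ^ 2) *
        ∏ j : Fin M, (1 + 2 * (Real.pi : ℂ) * Complex.I * (δ j : ℂ) * (ξ : ℂ))⁻¹)
    (α β : ℝ) (hα : 0 < α) (hβ : 0 < β)
    (hrat : ∃ r : ℚ, (r : ℝ) = α * β) (hle : α * β ≤ 1) :
    GaborSystem.IsCompleteSystem (GaborSystem.gaborSystem g α β) := by
  obtain ⟨r, hr⟩ := hrat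
  have hr0 : 0 < r := by exact_mod_cast hr ▸ mul_pos hα hβ
  have hr1 : r ≤ 1 := by exact_mod_cast hr ▸ hle
  obtain ⟨p, hp⟩ : ∃ p : ℕ, r.num = p := ⟨r.num.toNat, by
    have := Rat.num_pos.mpr hr0
    omega⟩
  have hp0 : p ≠ 0 := by
    have := Rat.num_pos.mpr hr0
    omega
  have hpq : p ≤ r.den := by
    have := Rat.num_le_denom_iff.mpr hr1
    omega
  have hαβ : α * β = p / r.den := by
    rw [← hr, Rat.cast_def, hp, Int.cast_natCast]
  rw [GaborSystem.IsCompleteSystem, Submodule.dense_iff_topologicalClosure_eq_top,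
    Submodule.topologicalClosure_eq_top_iff, Submodule.eq_bot_iff]
  intro f hf
  have horth : ∀ k l : ℤ, inner ℂ f (GaborSystem.timeFrequencyShift (β * l) (α * k) g) = 0 :=
    fun k l => (Submodule.mem_orthogonal' _ _).mp hf _ (Submodule.subset_span ⟨k, l, rfl⟩)
  set f' : Lp ℂ 2 (volume : Measure ℝ) := FourierTransform.fourier f with hf'
  -- The inner product conjugates its first argument, so uniqueness is applied to the conjugate of
  -- the transform.
  have hF : (fun ξ => (starRingEnd ℂ) (f' ξ)) =ᵐ[volume] 0 := by
    refine GaborSystem.ae_eq_zero_of_integral_window_eq_zero hγ δ (β := β) hα hp0 hpq hαβ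
      (Complex.continuous_conj.comp_stronglyMeasurable (Lp.stronglyMeasurable f'))
      ((Lp.memLp f').star) fun k l => ?_
    -- The transform turns translation by a into modulation by -a, hence the sign of k.
    have h1 := horth (-k) l
    rw [← Lp.inner_fourier_eq, GaborSystem.fourier_timeFrequencyShift, inner_smul_right,
      mul_eq_zero] at h1
    have h2 := h1.resolve_left fun h => by
      have := GaborSystem.norm_character (α * (-k : ℤ)) (β * l)
      rw [h, norm_zero] at this
      exact zero_ne_one this
    rw [L2.inner_def] at h2
    rw [← h2]
    refine integral_congr_ae ?_
    filter_upwards [GaborSystem.coeFn_timeFrequencyShift (-(α * (-k : ℤ))) (β * l)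
      (FourierTransform.fourier g), GaborSystem.ae_comp_sub hg (β * l)] with ξ h3 h4
    rw [h3, h4, RCLike.inner_apply, mul_comm]
    simp only [Int.cast_neg, mul_neg, neg_neg]
    rfl
  have h0 : f' = 0 := by
    refine Lp.ext ?_
    filter_upwards [hF, Lp.coeFn_zero ℂ 2 (volume : Measure ℝ)] with ξ h1 h2
    rw [h2]
    simpa using h1
  exact (Lp.fourierTransformₗᵢ ℝ ℂ).injective (h0.trans (map_zero _).symm)
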